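/- **Setting.** Let $f,g\in\mathbb C\{x,y\}$ be non-zero germs of holomorphic functions at the origin of $\mathbb C^2$ with $f(0,0)=g(0,0)=0$. An *arc* is a fractional power series $\xi(y)=\sum_{k\ge1}c_ky^{k/n}$ ($n\ge1$); $O_y$ denotes the order in $y$ and $O(\xi,\eta):=O_y(\xi-\eta)$. A (Newton–Puiseux) root of a germ $F$ is an arc $\xi$ with $F(\xi(y),y)=0$; its multiplicity is the order of vanishing of $F(x,y)$ at $x=\xi(y)$. Assume that all roots of $fg$ are simple; call them $\lambda_1,\dots,\lambda_N$. A *polar root* is a root $\gamma$ of $J=f_yg_x-f_xg_y$ with $f(\gamma(y),y)\,g(\gamma(y),y)\neq0$. **Tree.** A bar $B$ (of finite height) has a height $h(B)\in\mathbb Q$ and a series $\lambda_B$. An arc $\xi$ *climbs over $B$ at $a\in\mathbb C$* if $\xi=\lambda_B+ay^{h(B)}+(\text{higher order terms})$, and climbs over $B$ if it does so at some $a$; it is *bounded by $B$* if $O(\xi,\lambda_B)<h(B)$. The set of the $\lambda_k$ climbing over $B$ at $z$, if non-empty, is the *trunk* growing on $B$ at $z$; it has bimultiplicity $[p_z,q_z]$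 if it contains $p_z$ roots of $f$ and $q_z$ roots of $g$. The bars are obtained recursively, starting from the ground bar ($h=0$, $\lambda=0$): each trunk $T$, growing on a bar $B$ at $c$, with at least two members, carries one further bar $B^*$, with $h(B^*)=\min\{O(\lambda,\mu):\lambda\ne\mu\in T\}$ and $\lambda_{B^*}$ equal to any $\lambda\in T$ with all terms $y^e$, $e\ge h(B^*)$, omitted; one writes $B\perp_cB^*$, or $B\perp B^*$. **The rational function of a bar.** Let $\nu_F(B)$ be the order in $y$ of $F(\lambda_B(y)+zy^{h(B)},y)$ for generic $z$ (for the ground bar, the exponent of the largest power of $y$ dividing $F$). If $z_1,\dots,z_r$ are the points of $B$ at which trunks grow, and $z_k$ has bimultiplicity $[p_k,q_k]$, put $$\Delta_B(z_k)=\nu_f(B)\,q_k-\nu_g(B)\,p_k,\qquad \mathscr M_B(z)=\sum_{k=1}^r\frac{\Delta_B(z_k)}{z-z_k}.$$ The point $z_k$ is *collinear* if $\Delta_B(z_k)=0$, *non-collinear* otherwise; $C(B)$ is the set of collinear points and $n(B)$ the number of non-collinear points. The bar $B$ is *collinear* if all $\Delta_B(z_k)$ vanish, *non-collinear* otherwise.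 For non-collinear $B$, let $m_B(z)$ be the multiplicity of $z$ as a zero of $\mathscr M_B$ ($0$ if $z$ is not a zero) and $m(B)=\sum_{z\in\mathbb C}m_B(z)$. A *cover* of $c\in C(B)$ is a finite set of non-collinear bars $\bar B_1,\dots,\bar B_l$ such that (i) for each $s$ there is a sequence $B\perp_cB_1^*\perp\cdots\perp B_{r(s)}^*\perp\bar B_s$ with all $B_i^*$ collinear (or $r(s)=0$ and $B\perp_c\bar B_s$), and (ii) each $\lambda_k$ climbing over $B$ at $c$ climbs over a unique $\bar B_s$. **Theorem C.** Let $B$ be a non-collinear bar, and let $c\in C(B)$ have cover $\{\bar B_1,\dots,\bar B_l\}$. Then there are, counted with multiplicities as roots of $J$, exactly $$m_B(c)+\sum_{s=1}^l\bigl[n(\bar B_s)-m(\bar B_s)\bigr]$$ polar roots which climb over $B$ at $c$ and are bounded by every $\bar B_s$, $1\le s\le l$. -/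

import Mathlib

noncomputable section

namespace PolarRoots

/-! ### Germs, arcs and substitution -/

/-- Elements of `ℂ⟦x, y⟧`; the variable with index `0` is `x`, the one with index `1` is `y`. -/
abbrev Ser : Type := MvPowerSeries (Fin 2) ℂ

/-- Generalized power series in `y` with rational exponents. Fractional power series are the
elements selected by `IsArc` below. -/
abbrev Frac : Type := HahnSeries ℚ ℂ

/-- The coefficient of `x ^ i * y ^ j`. -/
def cf (F : Ser) (i j : ℕ) : ℂ :=
  MvPowerSeries.coeff (Finsupp.single 0 i + Finsupp.single 1 j) F

/-- `F` converges in a neighbourhood of the origin, that is, `F ∈ ℂ{x, y}`: it is (the Taylor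
expansion of) the germ of a holomorphic function at the origin of `ℂ²`. -/
def IsConvergent (F : Ser) : Prop :=
  ∃ C r : ℝ, ∀ i j : ℕ, ‖cf F i j‖ ≤ C * r ^ (i + j)

/-- The partial derivative with respect to `x`. -/
def dx (F : Ser) : Ser := MvPowerSeries.pderiv ℂ 0 F

/-- The partial derivative with respect to `y`. -/
def dy (F : Ser) : Ser := MvPowerSeries.pderiv ℂ 1 F

/-- The Jacobian determinant `f_y g_x - f_x g_y`. -/
def jac (f g : Ser) : Ser := dy f * dx g - dx f * dy g

/-- An arc: a fractional power series `ξ = ∑_{k ≥ 1} c_k y ^ (k / n)`, for some `n ≥ 1`, of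
positive order in `y`. (Such a series is automatically convergent when it is a root of a
non-zero convergent power series.) -/
def IsArc (ξ : Frac) : Prop :=
  0 < ξ.orderTop ∧ ∃ n : ℕ, 0 < n ∧ ∀ e ∈ ξ.support, ∃ k : ℕ, (n : ℚ) * e = k

/-- `F(ξ(y), y) = ∑_{i, j} F_{ij} ξ ^ i y ^ j`, for `ξ` of positive order. -/
def subst (F : Ser) (ξ : Frac) : Frac :=
  (HahnSeries.SummableFamily.smulFamily (fun ij : ℕ × ℕ => cf F ij.1 ij.2)
    ((HahnSeries.SummableFamily.powers ξ).mul
      (HahnSeries.SummableFamily.powers (HahnSeries.single (1 : ℚ) (1 : ℂ))))).hsum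

/-- `ξ` is a Newton-Puiseux root of `F`, of positive order. -/
def IsRoot (F : Ser) (ξ : Frac) : Prop := IsArc ξ ∧ subst F ξ = 0

/-- The multiplicity of `ξ` as a root of `F ≠ 0`: the order of vanishing of `F(x, y)` at
`x = ξ(y)`. -/
def rootMult (F : Ser) (ξ : Frac) : ℕ := sInf {m : ℕ | subst (dx^[m] F) ξ ≠ 0}

/-- All (Newton-Puiseux) roots of `F` are simple. -/
def HasSimpleRoots (F : Ser) : Prop := ∀ ξ, IsRoot F ξ → rootMult F ξ = 1

/-- `γ` is a polar root of the pair `(f, g)`. -/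
def IsPolarRoot (f g : Ser) (γ : Frac) : Prop :=
  IsRoot (jac f g) γ ∧ subst f γ * subst g γ ≠ 0

/-! ### The tree model -/

/-- A bar `B` is recorded by its height `h(B)` and the series `λ_B`. -/
@[ext] structure Bar where
  base : Frac
  height : ℚ

/-- The ground bar: height `0`, `λ_{B_*} = 0`. -/
def ground : Bar := ⟨0, 0⟩

/-- The arc `λ_B(y) + z y ^ h(B)`. -/
def arcOn (B : Bar) (z : ℂ) : Frac := B.base + HahnSeries.single B.height z

/-- `ξ` climbs over `B` at `a`: `ξ = λ_B + a y ^ h(B) + (higher order terms)`. -/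
def ClimbsAt (B : Bar) (ξ : Frac) (a : ℂ) : Prop :=
  (B.height : WithTop ℚ) < (ξ - arcOn B a).orderTop

/-- `ξ` climbs over `B`. -/
def Climbs (B : Bar) (ξ : Frac) : Prop := ∃ a, ClimbsAt B ξ a

/-- `ξ` is bounded by `B`: `O(ξ, λ_B) < h(B)`. -/
def BoundedBy (B : Bar) (ξ : Frac) : Prop :=
  (ξ - B.base).orderTop < (B.height : WithTop ℚ)

/-- The roots of `f` (or of `g`) which climb over `B` at `z`. -/
def rootsAt (F : Ser) (B : Bar) (z : ℂ) : Set Frac := {ξ | IsRoot F ξ ∧ ClimbsAt B ξ z}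

/-- The roots of `f` and `g` which climb over `B` at `z`; when non-empty, this is the trunk
growing on `B` at `z`. -/
def trunk (f g : Ser) (B : Bar) (z : ℂ) : Set Frac := rootsAt f B z ∪ rootsAt g B z

/-- The points `z_1, …, z_l` of `B` at which a trunk grows. -/
def points (f g : Ser) (B : Bar) : Set ℂ := {z | (trunk f g B z).Nonempty}

/-- `B ⊥_c B'`: the bar `B'` (of finite height) lies on top of the trunk growing on `B` at `c`.
Its height is the smallest contact order between members of the trunk, and `λ_{B'}` is the
truncation of any member of the trunk. -/
def PostBar (f g : Ser) (B : Bar) (c : ℂ) (B' : Bar) : Prop :=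
  IsLeast {h : ℚ | ∃ ξ ∈ trunk f g B c, ∃ η ∈ trunk f g B c, (ξ - η).orderTop = h} B'.height ∧
  ∃ ξ ∈ trunk f g B c, B'.base = HahnSeries.truncLT B'.height ξ

/-- The bars of finite height of the tree model `T(f, g)`. -/
inductive IsBar (f g : Ser) : Bar → Prop
  | ground : IsBar f g ground
  | post {B B' : Bar} {c : ℂ} : IsBar f g B → PostBar f g B c B' → IsBar f g B'

/-! ### The rational function of a bar -/

/-- `v` is the order in `y` of `F(λ_B(y) + z y ^ h(B), y)` for generic `z`. -/
def IsGenericOrder (F : Ser) (B : Bar) (v : ℚ) : Prop :=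
  ∀ᶠ z in Filter.cofinite, (subst F (arcOn B z)).orderTop = (v : WithTop ℚ)

/-- `ν_F(B)`, the order in `y` of `F(λ_B(y) + z y ^ h(B), y)` for generic `z`. On the ground bar,
where `λ_B(y) + z y ^ h(B)` is the constant `z`, this is the exponent of the largest power of
`y` which divides `F`. -/
def nu (F : Ser) (B : Bar) : ℚ :=
  if B.height = 0 then (multiplicity (MvPowerSeries.X 1 : Ser) F : ℚ)
  else Classical.epsilon (IsGenericOrder F B)

/-- `Δ_B(z)`, the determinant with rows `(ν_f(B), p)` and `(ν_g(B), q)`, where `[p, q]` is the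
bimultiplicity of `z` on `B`. -/
def Delta (f g : Ser) (B : Bar) (z : ℂ) : ℚ :=
  nu f B * (rootsAt g B z).ncard - nu g B * (rootsAt f B z).ncard

/-- `C(B)`, the collinear points of `B`. -/
def collinearPts (f g : Ser) (B : Bar) : Set ℂ := {z ∈ points f g B | Delta f g B z = 0}

/-- `N(B)`, the non-collinear points of `B`. -/
def noncollinearPts (f g : Ser) (B : Bar) : Set ℂ := {z ∈ points f g B | Delta f g B z ≠ 0}

/-- `B` is a collinear bar. -/
def IsCollinear (f g : Ser) (B : Bar) : Prop := ∀ z ∈ points f g B, Delta f g B z = 0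

/-- `n(B)`, the number of non-collinear points. -/
def nPts (f g : Ser) (B : Bar) : ℕ := (noncollinearPts f g B).ncard

/-- The rational function associated to `B`: the sum of the `Δ_B(z_k) / (z - z_k)`. (The terms
with `Δ_B(z_k) = 0` vanish, and so do those with `z_k` not in `points f g B`.) -/
def mero (f g : Ser) (B : Bar) : RatFunc ℂ :=
  ∑ᶠ z : ℂ, RatFunc.C (Delta f g B z : ℂ) / (RatFunc.X - RatFunc.C z)

/-- `m_B(z)`, the multiplicity of `z` as a zero of the rational function associated to a
non-collinear bar `B` (it is `0` if `z` is not a zero). -/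
def meroMult (f g : Ser) (B : Bar) (z : ℂ) : ℕ := (mero f g B).num.rootMultiplicity z

/-- `m(B)`, the number of zeros, with multiplicities, of the rational function associated to a
non-collinear bar `B`. -/
def meroTotal (f g : Ser) (B : Bar) : ℕ := ∑ᶠ z : ℂ, meroMult f g B z

/-! ### Covers -/

/-- `B'` lies over the point `c` of `B`, and all bars strictly between `B` and `B'` are
collinear: `B ⊥_c B_1 ⊥ ⋯ ⊥ B_r ⊥ B'` with `B_1, …, B_r` collinear, `r ≥ 0`. -/
def LiesMinimallyOver (f g : Ser) (B : Bar) (c : ℂ) (B' : Bar) : Prop :=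
  ∃ B₁, PostBar f g B c B₁ ∧
    Relation.ReflTransGen (fun X Y => IsCollinear f g X ∧ ∃ d, PostBar f g X d Y) B₁ B'

/-- The finite set `S` of bars is a (non-collinear) cover of the point `c` of `B`. -/
def IsCover (f g : Ser) (B : Bar) (c : ℂ) (S : Finset Bar) : Prop :=
  (∀ B' ∈ S, ¬ IsCollinear f g B' ∧ LiesMinimallyOver f g B c B') ∧
  ∀ ξ ∈ trunk f g B c, ∃! B', B' ∈ S ∧ Climbs B' ξ

/-- The polar roots which climb over `B` at `c` and are bounded by every bar of `S`. -/
def polarRootsBetween (f g : Ser) (B : Bar) (c : ℂ) (S : Finset Bar) : Set Frac :=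
  {γ | IsPolarRoot f g γ ∧ ClimbsAt B γ c ∧ ∀ B' ∈ S, BoundedBy B' γ}

end PolarRoots

end

/-! The chain rule gives, along any arc `ξ`, the identity y·J(ξ) = (y d/dy f(ξ))·g_x(ξ) − f_x(ξ)·(y
d/dy g(ξ)) (`subst_jac`). Evaluate it on the arcs λ_B + z y^h(B). Let P and Q be the monic
polynomials whose roots are the points where the roots of f and of g climb over B. Then f has
leading term const·P(z)·y^ν_f. The Euler derivation multiplies it by ν_f, and f_x/f has leading term
(P'/P)(z)·y^(−h), because roots not climbing over B contribute only higher order. Hence the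
coefficient at the expected order of y·J is a nonzero constant times ν_f P Q' − ν_g P' Q = P Q · M_B
(`exists_hasLead_jac`, `algebraMap_jacPoly`), where M_B is the rational function of B.

On a non-collinear bar this polynomial is nonzero. J therefore has a genuine leading term there, and
its roots climb over B exactly at the zeros of P Q M_B, with multiplicities
(`exists_rootPoly_jac_eq`). In lowest terms M_B has a simple pole at each non-collinear point and no
other pole. Comparing multiplicities at a collinear point c, J has m_B(c) more roots there than fg
(`count_coords_jac`). Comparing degrees, over a cover bar J has n − m fewer roots than fg
(`card_coords_jac`).

Each root of J climbing over B at c either climbs over exactly one cover bar or is bounded by all of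
them, and roots of fg are never of the second kind (`IsCover.card_filter`,
`IsCover.card_filter_of_isRoot`). Subtracting the counts over the cover bars from the count at c
cancels the roots of fg and leaves the formula. Since the roots of fg are simple, J vanishes along
none of them, so every root of J is polar (`isPolarRoot_iff`).

All counting is done with the multiset of roots `HasRoots`, which comes from Weierstrass preparation
and the Newton–Puiseux theorem (`exists_hasRoots`, `puiseux_splits`). -/

noncomputable section

namespace PolarRoots

open HahnSeries

/-! ### Leading terms of generalized power series -/

/-- `x = c y ^ q + (higher order terms)`, where `c` may vanish. -/
def HasLead (x : Frac) (q : ℚ) (c : ℂ) : Prop := (q : WithTop ℚ) < (x - single q c).orderTop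

theorem lt_orderTop_iff {x : Frac} {q : ℚ} :
    (q : WithTop ℚ) < x.orderTop ↔ ∀ e ≤ q, x.coeff e = 0 := by
  constructor
  · intro h e he
    exact coeff_eq_zero_of_lt_orderTop (lt_of_le_of_lt (by exact_mod_cast he) h)
  · intro h
    by_contra hlt
    rw [not_lt] at hlt
    have hx : x ≠ 0 := by
      rintro rfl
      simp at hlt
    obtain ⟨g, hg⟩ := WithTop.ne_top_iff_exists.1 (orderTop_ne_top.2 hx)
    rw [← hg] at hlt
    exact coeff_orderTop_ne hg.symm (h g (by exact_mod_cast hlt))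

theorem hasLead_iff {x : Frac} {q : ℚ} {c : ℂ} :
    HasLead x q c ↔ (q : WithTop ℚ) ≤ x.orderTop ∧ x.coeff q = c := by
  rw [HasLead, lt_orderTop_iff, le_orderTop_iff_forall]
  constructor
  · intro h
    refine ⟨fun e he => ?_, ?_⟩
    · have he' : e < q := by exact_mod_cast he
      simpa [coeff_single_of_ne he'.ne] using h e he'.le
    · simpa [sub_eq_zero] using h q le_rfl
  · rintro ⟨h, rfl⟩ e he
    rcases he.eq_or_lt with rfl | he
    · simp
    · simp [coeff_single_of_ne he.ne, h e (by exact_mod_cast he)]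

namespace HasLead

variable {x y : Frac} {q r : ℚ} {c d : ℂ}

theorem le (h : HasLead x q c) : (q : WithTop ℚ) ≤ x.orderTop := (hasLead_iff.1 h).1

theorem coeff_eq (h : HasLead x q c) : x.coeff q = c := (hasLead_iff.1 h).2

theorem unique (h : HasLead x q c) (h' : HasLead x q d) : c = d := h.coeff_eq.symm.trans h'.coeff_eq

theorem orderTop_eq (h : HasLead x q c) (hc : c ≠ 0) : x.orderTop = q :=
  le_antisymm (orderTop_le_of_coeff_ne_zero (by rwa [h.coeff_eq])) h.le

theorem ne_zero (h : HasLead x q c) (hc : c ≠ 0) : x ≠ 0 := by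
  rintro rfl
  exact hc (by simpa using h.coeff_eq.symm)

theorem add (hx : HasLead x q c) (hy : HasLead y q d) : HasLead (x + y) q (c + d) := by
  rw [hasLead_iff] at *
  refine ⟨le_trans (le_min hx.1 hy.1) min_orderTop_le_orderTop_add, by simp [hx.2, hy.2]⟩

theorem neg (hx : HasLead x q c) : HasLead (-x) q (-c) := by
  rw [hasLead_iff] at *
  simp [hx.1, hx.2]

theorem sub (hx : HasLead x q c) (hy : HasLead y q d) : HasLead (x - y) q (c - d) := by
  simpa [sub_eq_add_neg] using hx.add hy.neg

theorem of_lt (h : (q : WithTop ℚ) < x.orderTop) : HasLead x q 0 := by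
  simpa [HasLead] using h

theorem lower (hx : HasLead x q c) (h : r < q) : HasLead x r 0 :=
  of_lt (lt_of_lt_of_le (by exact_mod_cast h) hx.le)

theorem lt_of_zero (h : HasLead x q 0) : (q : WithTop ℚ) < x.orderTop := by
  simpa [HasLead] using h

theorem single (q : ℚ) (c : ℂ) : HasLead (single q c) q c := by
  simp [HasLead]

theorem zero : HasLead 0 q 0 := by simp [HasLead]

theorem one : HasLead 1 0 1 := HasLead.single 0 1

theorem mul (hx : HasLead x q c) (hy : HasLead y r d) : HasLead (x * y) (q + r) (c * d) := by
  have h1 : x * y - HahnSeries.single (q + r) (c * d) =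
      (x - HahnSeries.single q c) * y + HahnSeries.single q c * (y - HahnSeries.single r d) := by
    rw [mul_sub, single_mul_single]; ring
  rw [HasLead, h1]
  refine lt_of_lt_of_le (lt_min ?_ ?_) min_orderTop_le_orderTop_add
  · rw [orderTop_mul, WithTop.coe_add]
    exact WithTop.add_lt_add_of_lt_of_le (by simp) hx hy.le
  · rw [orderTop_mul, WithTop.coe_add]
    exact WithTop.add_lt_add_of_le_of_lt (by simp) orderTop_single_le hy

/-- The leading term of the inverse is forced by multiplicativity and x·x⁻¹ = 1. -/
theorem inv (hx : HasLead x q c) (hc : c ≠ 0) : HasLead x⁻¹ (-q) c⁻¹ := by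
  have hx0 := hx.ne_zero hc
  have h := orderTop_mul x x⁻¹
  have hl := leadingCoeff_mul x x⁻¹
  have hxi : x⁻¹ ≠ 0 := inv_ne_zero hx0
  obtain ⟨g, hg⟩ := WithTop.ne_top_iff_exists.1 (orderTop_ne_top.2 hxi)
  have hgi : HasLead x⁻¹ g (x⁻¹.coeff g) := hasLead_iff.2 ⟨hg.le, rfl⟩
  rw [mul_inv_cancel₀ hx0, hx.orderTop_eq hc, ← hg, orderTop_one] at h
  have hq : g = -q := by
    have : (0 : ℚ) = q + g := by exact_mod_cast h
    linarith
  have h1 := hx.mul hgi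
  rw [mul_inv_cancel₀ hx0, hq, add_neg_cancel] at h1
  have h2 := h1.unique one
  rw [hq] at hgi
  rwa [eq_inv_of_mul_eq_one_right h2] at hgi

theorem div (hx : HasLead x q c) (hy : HasLead y r d) (hd : d ≠ 0) :
    HasLead (x / y) (q - r) (c / d) := by
  simpa [div_eq_mul_inv, sub_eq_add_neg] using hx.mul (hy.inv hd)

theorem pow (hx : HasLead x q c) (n : ℕ) : HasLead (x ^ n) (n * q) (c ^ n) := by
  induction n with
  | zero => simpa using one
  | succ n ih =>
    have h := ih.mul hx
    rwa [← pow_succ, ← pow_succ, show (n : ℚ) * q + q = ((n + 1 : ℕ) : ℚ) * q by push_cast; ring]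
      at h

theorem multiset_sum {ι : Type*} (s : Multiset ι) {u : ι → Frac} {a : ι → ℂ}
    (h : ∀ i ∈ s, HasLead (u i) q (a i)) : HasLead (s.map u).sum q (s.map a).sum := by
  induction s using Multiset.induction_on with
  | empty => simpa using zero
  | cons i s ih =>
    simp only [Multiset.map_cons, Multiset.sum_cons]
    exact (h i (by simp)).add (ih fun j hj => h j (by simp [hj]))

theorem exists_of_ne_zero (hx : x ≠ 0) : ∃ q c, c ≠ 0 ∧ HasLead x q c := by
  obtain ⟨g, hg⟩ := WithTop.ne_top_iff_exists.1 (orderTop_ne_top.2 hx)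
  exact ⟨g, x.coeff g, coeff_orderTop_ne hg.symm, hasLead_iff.2 ⟨hg.le, rfl⟩⟩

end HasLead

/-! ### The Euler derivation `y d/dy` -/

/-- The Euler derivation `y d/dy`. -/
def euler : Frac →+ Frac where
  toFun x := ⟨fun e => (e : ℂ) * x.coeff e, x.isPWO_support.mono fun e he => by
    simp only [Function.mem_support, ne_eq, mul_eq_zero, not_or] at he
    exact he.2⟩
  map_zero' := by ext; simp
  map_add' x y := by ext; simp [mul_add]

@[simp]
theorem coeff_euler (x : Frac) (e : ℚ) : (euler x).coeff e = (e : ℂ) * x.coeff e := rfl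

theorem support_euler_subset (x : Frac) : (euler x).support ⊆ x.support := fun e he => by
  simp only [mem_support, coeff_euler, ne_eq, mul_eq_zero, not_or] at he
  exact he.2

theorem euler_mul (x y : Frac) : euler (x * y) = euler x * y + x * euler y := by
  ext e
  -- The Euler derivation only shrinks supports, so all three products can be summed over the same
  -- antidiagonal; there the factor e splits as the sum of the two exponents.
  rw [coeff_euler, coeff_add, coeff_mul_left' x.isPWO_support (support_euler_subset x),
    coeff_mul_right' y.isPWO_support (support_euler_subset y), coeff_mul, Finset.mul_sum,
    ← Finset.sum_add_distrib]
  refine Finset.sum_congr rfl fun p hp => ?_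
  rw [Finset.mem_antidiagonal] at hp
  simp only [coeff_euler, ← hp.2.2]
  push_cast; ring

theorem euler_C (c : ℂ) : euler (C c) = 0 := by
  ext e
  by_cases h : e = 0
  · simp [h]
  · simp [C_apply, coeff_single_of_ne h]

theorem euler_C_mul (c : ℂ) (x : Frac) : euler (C c * x) = C c * euler x := by
  rw [euler_mul, euler_C, zero_mul, zero_add]

theorem euler_one : euler 1 = 0 := by
  simpa using euler_C 1

theorem euler_pow_succ (x : Frac) (n : ℕ) :
    euler (x ^ (n + 1)) = (n + 1) * (x ^ n * euler x) := by
  induction n with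
  | zero => simp
  | succ n ih =>
    rw [pow_succ, euler_mul, ih]
    push_cast
    ring

theorem euler_single (q : ℚ) (c : ℂ) : euler (single q c) = single q ((q : ℂ) * c) := by
  ext e
  by_cases h : e = q
  · subst h; simp
  · simp [coeff_single_of_ne h]

/-- The exponent appears as a factor of the leading coefficient; this is how ν_f and ν_g enter the
rational function of a bar. -/
theorem HasLead.euler {x : Frac} {q : ℚ} {c : ℂ} (h : HasLead x q c) :
    HasLead (euler x) q (q * c) := by
  rw [hasLead_iff] at *
  refine ⟨?_, by simp [h.2]⟩
  rw [le_orderTop_iff_forall] at *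
  intro e he
  simp [h.1 e he]

end PolarRoots
end

noncomputable section

namespace PolarRoots

open HahnSeries

/-! ### Substitution is a ring homomorphism -/

/-- In a fixed degree only finitely many pairs of indices contribute, and since `t` turns sums into
products, grouping them by their sum gives the Cauchy product. -/
theorem hsum_smulFamily_mul {σ : Type*} [AddMonoid σ] [Finset.HasAntidiagonal σ] [DecidableEq σ]
    (t : SummableFamily ℚ ℂ σ) (ht : ∀ a b, t (a + b) = t a * t b) (F G : σ → ℂ) :
    (SummableFamily.smulFamily (fun n => ∑ p ∈ Finset.HasAntidiagonal.antidiagonal n, F p.1 * G p.2) t).hsum =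
      (SummableFamily.smulFamily F t).hsum * (SummableFamily.smulFamily G t).hsum := by
  rw [← SummableFamily.hsum_mul]
  ext g
  rw [SummableFamily.coeff_hsum, SummableFamily.coeff_hsum]
  set φ : σ × σ → ℂ := fun p => F p.1 * G p.2 * (t (p.1 + p.2)).coeff g with hφ
  have h1 : ∀ p : σ × σ, (((SummableFamily.smulFamily F t).mul
      (SummableFamily.smulFamily G t)) p).coeff g = φ p := fun p => by
    have : F p.1 • t p.1 * G p.2 • t p.2 = C (F p.1 * G p.2) * (t p.1 * t p.2) := by
      rw [← C_mul_eq_smul, ← C_mul_eq_smul, map_mul]; ring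
    simp only [SummableFamily.mul_toFun, SummableFamily.smulFamily_toFun, hφ, ht, this,
      C_mul_eq_smul, coeff_smul, smul_eq_mul]
  have hfin : (Function.support φ).Finite := by
    refine (SummableFamily.finite_co_support ((SummableFamily.smulFamily F t).mul
      (SummableFamily.smulFamily G t)) g).subset fun p hp => ?_
    rw [Function.mem_support] at hp ⊢
    rwa [h1]
  have h2 : ∀ n, ((SummableFamily.smulFamily
      (fun n => ∑ p ∈ Finset.HasAntidiagonal.antidiagonal n, F p.1 * G p.2) t) n).coeff g =
      ∑ p ∈ Finset.HasAntidiagonal.antidiagonal n, φ p := fun n => by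
    simp only [SummableFamily.smulFamily_toFun, coeff_smul, smul_eq_mul, Finset.sum_mul, hφ]
    refine Finset.sum_congr rfl fun p hp => ?_
    rw [Finset.HasAntidiagonal.mem_antidiagonal.1 hp]
  simp only [h1, h2]
  have hT : ∀ p, p ∉ hfin.toFinset → φ p = 0 := fun p hp => by simpa using hp
  rw [finsum_eq_sum_of_support_subset φ (s := hfin.toFinset) (by simp),
    finsum_eq_sum_of_support_subset _ (s := hfin.toFinset.image fun p => p.1 + p.2)]
  · rw [← Finset.sum_fiberwise_of_maps_to (g := fun p : σ × σ => p.1 + p.2)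
      (t := hfin.toFinset.image fun p => p.1 + p.2)
      fun p hp => Finset.mem_image_of_mem _ hp]
    refine Finset.sum_congr rfl fun n _ => (Finset.sum_subset ?_ ?_).symm
    · intro p hp
      simpa using (Finset.mem_filter.1 hp).2
    · intro p hp hp'
      refine hT p fun hpT => hp' (Finset.mem_filter.2 ⟨hpT, by simpa using hp⟩)
  · intro n hn
    obtain ⟨p, hp, hp0⟩ := Finset.exists_ne_zero_of_sum_ne_zero hn
    refine Finset.mem_coe.2 (Finset.mem_image.2 ⟨p, ?_, by simpa using hp⟩)
    by_contra h
    exact hp0 (hT p h)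

/-- Pairs of exponents as multi-indices. -/
def expEquiv : ℕ × ℕ ≃ (Fin 2 →₀ ℕ) where
  toFun ij := Finsupp.single 0 ij.1 + Finsupp.single 1 ij.2
  invFun m := (m 0, m 1)
  left_inv ij := by simp
  right_inv m := by
    ext k
    fin_cases k <;> simp

theorem coeff_eq_cf (F : Ser) (m : Fin 2 →₀ ℕ) : MvPowerSeries.coeff m F = cf F (m 0) (m 1) := by
  rw [cf]
  congr 1
  exact congrArg (fun m => MvPowerSeries.coeff m) (expEquiv.right_inv m).symm

theorem ser_ext {F G : Ser} (h : ∀ i j, cf F i j = cf G i j) : F = G := by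
  ext m
  rw [coeff_eq_cf, coeff_eq_cf, h]

/-- The summable family of the `ξ ^ i * y ^ j`. -/
abbrev monomials (ξ : Frac) : SummableFamily ℚ ℂ (ℕ × ℕ) :=
  (SummableFamily.powers ξ).mul (SummableFamily.powers (single (1 : ℚ) (1 : ℂ)))

theorem single_one_orderTop_pos : 0 < (single (1 : ℚ) (1 : ℂ)).orderTop := by
  rw [orderTop_single one_ne_zero]; exact_mod_cast zero_lt_one

theorem monomials_apply {ξ : Frac} (hξ : 0 < ξ.orderTop) (p : ℕ × ℕ) :
    monomials ξ p = ξ ^ p.1 * single (1 : ℚ) (1 : ℂ) ^ p.2 := by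
  simp [monomials, hξ]

/-- Reindexing by multi-indices matches the antidiagonal sums in the product of `MvPowerSeries`. -/
theorem subst_eq_hsum (F : Ser) (ξ : Frac) :
    subst F ξ = (SummableFamily.smulFamily (fun m => MvPowerSeries.coeff m F)
      (SummableFamily.Equiv expEquiv (monomials ξ))).hsum := by
  rw [subst, ← SummableFamily.hsum_equiv expEquiv]
  congr 1
  ext1 m
  simp only [SummableFamily.Equiv, SummableFamily.coe_mk, SummableFamily.smulFamily_toFun,
    coeff_eq_cf F m]
  rfl

theorem subst_mul (F G : Ser) {ξ : Frac} (hξ : 0 < ξ.orderTop) :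
    subst (F * G) ξ = subst F ξ * subst G ξ := by
  classical
  rw [subst_eq_hsum, subst_eq_hsum, subst_eq_hsum, ← hsum_smulFamily_mul]
  · simp only [MvPowerSeries.coeff_mul]
  · intro a b
    simp only [SummableFamily.Equiv, SummableFamily.coe_mk, monomials_apply hξ]
    simp only [expEquiv, Equiv.coe_fn_symm_mk, Finsupp.add_apply, _root_.pow_add]
    ring

theorem subst_add (F G : Ser) (ξ : Frac) : subst (F + G) ξ = subst F ξ + subst G ξ := by
  rw [subst_eq_hsum, subst_eq_hsum, subst_eq_hsum, ← SummableFamily.hsum_add]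
  congr 1
  ext1 m
  simp only [SummableFamily.add_apply, SummableFamily.smulFamily_toFun, map_add,
    ← C_mul_eq_smul, add_mul]

theorem subst_eq_of_forall_ne {F : Ser} {ξ : Frac} (m : ℕ × ℕ)
    (h : ∀ p ≠ m, cf F p.1 p.2 = 0) : subst F ξ = cf F m.1 m.2 • monomials ξ m := by
  ext g
  rw [subst, SummableFamily.coeff_hsum, finsum_eq_single _ m fun p hp => by simp [h p hp]]
  simp

theorem cf_C (c : ℂ) (i j : ℕ) : cf (MvPowerSeries.C c) i j = if i = 0 ∧ j = 0 then c else 0 := by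
  classical
  rw [cf, MvPowerSeries.coeff_C]
  congr 1
  simp [Finsupp.ext_iff, Fin.forall_fin_two]

theorem subst_C (c : ℂ) {ξ : Frac} (hξ : 0 < ξ.orderTop) :
    subst (MvPowerSeries.C c) ξ = C c := by
  rw [subst_eq_of_forall_ne (0, 0), monomials_apply hξ, cf_C]
  · simp [← C_mul_eq_smul]
  · rintro ⟨i, j⟩ h
    rw [cf_C, if_neg]
    simpa using h

/-- Substitution as a ring homomorphism. -/
def substHom (ξ : Frac) (hξ : 0 < ξ.orderTop) : Ser →+* Frac where
  toFun F := subst F ξ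
  map_one' := by simpa using subst_C 1 hξ
  map_zero' := by simpa using subst_C 0 hξ
  map_mul' F G := subst_mul F G hξ
  map_add' F G := subst_add F G ξ

@[simp]
theorem substHom_apply (ξ : Frac) (hξ : 0 < ξ.orderTop) (F : Ser) :
    substHom ξ hξ F = subst F ξ := rfl

theorem cf_X (k : Fin 2) (i j : ℕ) : cf (MvPowerSeries.X k) i j =
    if Finsupp.single 0 i + Finsupp.single 1 j = Finsupp.single k 1 then 1 else 0 := by
  classical
  rw [cf, MvPowerSeries.coeff_X]

theorem subst_X_zero {ξ : Frac} (hξ : 0 < ξ.orderTop) : subst (MvPowerSeries.X 0) ξ = ξ := by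
  rw [subst_eq_of_forall_ne (1, 0), monomials_apply hξ, cf_X]
  · simp
  · rintro ⟨i, j⟩ h
    rw [cf_X, if_neg]
    simpa [Finsupp.ext_iff, Fin.forall_fin_two] using h

theorem subst_X_one {ξ : Frac} (hξ : 0 < ξ.orderTop) :
    subst (MvPowerSeries.X 1) ξ = single 1 1 := by
  rw [subst_eq_of_forall_ne (0, 1), monomials_apply hξ, cf_X]
  · simp
  · rintro ⟨i, j⟩ h
    rw [cf_X, if_neg]
    simpa [Finsupp.ext_iff, Fin.forall_fin_two] using h

theorem orderTop_pos_iff {x : Frac} : 0 < x.orderTop ↔ HasLead x 0 0 := by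
  simp [HasLead]

/-- Every monomial other than 1 has positive order along `ξ`. In particular a unit of ℂ⟦x, y⟧ has
order 0 along every arc. -/
theorem hasLead_subst (F : Ser) {ξ : Frac} (hξ : 0 < ξ.orderTop) :
    HasLead (subst F ξ) 0 (MvPowerSeries.constantCoeff F) := by
  have hpos : ∀ p : ℕ × ℕ, p ≠ 0 → HasLead (monomials ξ p) 0 0 := fun p hp => by
    rw [monomials_apply hξ]
    have h1 := ((orderTop_pos_iff.1 hξ).pow p.1).mul
      ((orderTop_pos_iff.1 single_one_orderTop_pos).pow p.2)
    have h2 : (0 : ℂ) ^ p.1 * 0 ^ p.2 = 0 := by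
      rcases p with ⟨i, j⟩
      rcases i with _ | i
      · rcases j with _ | j
        · exact absurd rfl hp
        · simp
      · simp
    simpa [h2] using h1
  have hzero : ∀ e < 0, (monomials ξ 0).coeff e = 0 := fun e he => by
    rw [monomials_apply hξ]
    simp [coeff_one, he.ne]
  rw [hasLead_iff, le_orderTop_iff_forall]
  constructor
  · intro e he
    have he : e < 0 := by exact_mod_cast he
    rw [subst, SummableFamily.coeff_hsum]
    refine finsum_eq_zero_of_forall_eq_zero fun p => ?_
    rw [SummableFamily.smulFamily_toFun, coeff_smul]
    rcases eq_or_ne p 0 with rfl | hp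
    · rw [hzero e he, smul_zero]
    · rw [lt_orderTop_iff.1 (hpos p hp).lt_of_zero e he.le, smul_zero]
  · rw [subst, SummableFamily.coeff_hsum, finsum_eq_single _ 0]
    · rw [SummableFamily.smulFamily_toFun, coeff_smul, monomials_apply hξ]
      simp [cf]
    · intro p hp
      rw [SummableFamily.smulFamily_toFun, coeff_smul, (hpos p hp).coeff_eq, smul_zero]

/-! ### The chain rule -/

theorem cf_dx (F : Ser) (i j : ℕ) : cf (dx F) i j = (i + 1) * cf F (i + 1) j := by
  rw [cf, dx, MvPowerSeries.coeff_pderiv, cf]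
  have : (Finsupp.single 0 i + Finsupp.single 1 j + Finsupp.single 0 1 : Fin 2 →₀ ℕ) =
      Finsupp.single 0 (i + 1) + Finsupp.single 1 j := by
    rw [Finsupp.single_add]; abel
  rw [this]
  simp [mul_comm]

theorem cf_dy (F : Ser) (i j : ℕ) : cf (dy F) i j = (j + 1) * cf F i (j + 1) := by
  rw [cf, dy, MvPowerSeries.coeff_pderiv, cf]
  have : (Finsupp.single 0 i + Finsupp.single 1 j + Finsupp.single 1 1 : Fin 2 →₀ ℕ) =
      Finsupp.single 0 i + Finsupp.single 1 (j + 1) := by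
    rw [Finsupp.single_add]; abel
  rw [this]
  simp [mul_comm]

/-- Applying the Euler derivation to each member of a summable family. -/
def eulerFamily {α : Type*} (s : SummableFamily ℚ ℂ α) : SummableFamily ℚ ℂ α where
  toFun a := euler (s a)
  isPWO_iUnion_support' := s.isPWO_iUnion_support.mono
    (Set.iUnion_mono fun a => support_euler_subset (s a))
  finite_co_support' g := (s.finite_co_support g).subset fun a ha => by
    simp only [Function.mem_support, coeff_euler, ne_eq, mul_eq_zero, not_or] at ha ⊢
    exact ha.2

theorem hsum_eulerFamily {α : Type*} (s : SummableFamily ℚ ℂ α) :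
    (eulerFamily s).hsum = euler s.hsum := by
  ext g
  rw [SummableFamily.coeff_hsum, coeff_euler, SummableFamily.coeff_hsum]
  exact (mul_finsum' _ _ (s.finite_co_support g)).symm

/-- The chain rule for `F(ξ(y), y)`, multiplied by `y`. -/
theorem euler_subst (F : Ser) {ξ : Frac} (hξ : 0 < ξ.orderTop) :
    euler (subst F ξ) = subst (dx F) ξ * euler ξ + subst (dy F) ξ * single 1 1 := by
  have hx : Function.Injective (fun p : ℕ × ℕ => (p.1 + 1, p.2)) := fun p q h => by
    simpa [Prod.ext_iff] using h
  have hy : Function.Injective (fun p : ℕ × ℕ => (p.1, p.2 + 1)) := fun p q h => by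
    simpa [Prod.ext_iff] using h
  set t := monomials ξ with ht
  -- Shifting the index by one moves the term of F_x coming from x^i y^j back to position (i, j), so
  -- that the chain rule can be checked monomial by monomial.
  have e1 : subst (dx F) ξ * euler ξ = (SummableFamily.embDomain
      (euler ξ • SummableFamily.smulFamily (fun p : ℕ × ℕ => cf (dx F) p.1 p.2) t)
      ⟨_, hx⟩).hsum := by
    rw [SummableFamily.hsum_embDomain, SummableFamily.hsum_smul, mul_comm, subst]
  have e2 : subst (dy F) ξ * single 1 1 = (SummableFamily.embDomain
      ((single (1 : ℚ) (1 : ℂ)) •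
        SummableFamily.smulFamily (fun p : ℕ × ℕ => cf (dy F) p.1 p.2) t) ⟨_, hy⟩).hsum := by
    rw [SummableFamily.hsum_embDomain, SummableFamily.hsum_smul, mul_comm, subst]
  rw [e1, e2, ← SummableFamily.hsum_add, subst, ← hsum_eulerFamily]
  congr 1
  ext1 ⟨i, j⟩
  -- The truncated exponent `i - 1` is harmless at i = 0, where the factor i vanishes.
  have key : ∀ i j : ℕ, euler (t (i, j)) =
      (i : Frac) * (ξ ^ (i - 1) * single (1 : ℚ) (1 : ℂ) ^ j * euler ξ) +
      (j : Frac) * (ξ ^ i * single (1 : ℚ) (1 : ℂ) ^ j) := by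
    intro i j
    have hj : euler (single (1 : ℚ) (1 : ℂ) ^ j) = (j : Frac) * single (1 : ℚ) (1 : ℂ) ^ j := by
      rcases j with _ | j
      · simp [euler_one]
      · rw [euler_pow_succ, euler_single]
        push_cast
        ring_nf
    rw [ht, monomials_apply hξ, euler_mul, hj]
    rcases i with _ | i
    · simp [euler_one]
    · rw [euler_pow_succ]
      push_cast
      ring
  have hsm : ∀ (x : Frac) (s : SummableFamily ℚ ℂ (ℕ × ℕ)) p, (x • s) p = x * s p :=
    fun x s p => rfl
  have h1 : (SummableFamily.embDomain (euler ξ •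
      SummableFamily.smulFamily (fun p : ℕ × ℕ => cf (dx F) p.1 p.2) t) ⟨_, hx⟩) (i, j) =
      C (cf F i j) * ((i : Frac) * (ξ ^ (i - 1) * single (1 : ℚ) (1 : ℂ) ^ j * euler ξ)) := by
    rcases i with _ | i
    · rw [SummableFamily.embDomain_of_notMem_range]
      · simp
      · simp
    · have := SummableFamily.embDomain_image (euler ξ •
        SummableFamily.smulFamily (fun p : ℕ × ℕ => cf (dx F) p.1 p.2) t) ⟨_, hx⟩ (a := (i, j))
      simp only [Function.Embedding.coeFn_mk] at this
      rw [this, hsm, SummableFamily.smulFamily_toFun, ht, monomials_apply hξ, cf_dx,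
        ← C_mul_eq_smul]
      simp only [map_mul, map_add, map_one, map_natCast, Nat.cast_add, Nat.cast_one,
        add_tsub_cancel_right]
      ring
  have h2 : (SummableFamily.embDomain ((single (1 : ℚ) (1 : ℂ)) •
      SummableFamily.smulFamily (fun p : ℕ × ℕ => cf (dy F) p.1 p.2) t) ⟨_, hy⟩) (i, j) =
      C (cf F i j) * ((j : Frac) * (ξ ^ i * single (1 : ℚ) (1 : ℂ) ^ j)) := by
    rcases j with _ | j
    · rw [SummableFamily.embDomain_of_notMem_range]
      · simp
      · simp
    · have := SummableFamily.embDomain_image ((single (1 : ℚ) (1 : ℂ)) •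
        SummableFamily.smulFamily (fun p : ℕ × ℕ => cf (dy F) p.1 p.2) t) ⟨_, hy⟩ (a := (i, j))
      simp only [Function.Embedding.coeFn_mk] at this
      rw [this, hsm, SummableFamily.smulFamily_toFun, ht, monomials_apply hξ, cf_dy,
        ← C_mul_eq_smul]
      simp only [map_mul, map_add, map_one, map_natCast, Nat.cast_add, Nat.cast_one, pow_succ]
      ring
  rw [SummableFamily.add_apply, h1, h2, ← mul_add, ← key, ← euler_C_mul, C_mul_eq_smul]
  rfl

/-- `y J(ξ)` as a determinant of the logarithmic variation along `ξ`. -/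
theorem subst_jac (f g : Ser) {ξ : Frac} (hξ : 0 < ξ.orderTop) :
    single 1 1 * subst (jac f g) ξ =
      euler (subst f ξ) * subst (dx g) ξ - subst (dx f) ξ * euler (subst g ξ) := by
  rw [euler_subst f hξ, euler_subst g hξ, ← substHom_apply ξ hξ (jac f g), jac, map_sub, map_mul,
    map_mul]
  simp only [substHom_apply]
  ring

end PolarRoots
end

noncomputable section

namespace PolarRoots

open HahnSeries

/-! ### Hensel factorization over `ℂ⟦t⟧` -/

/-- Completeness is what Weierstrass preparation over ℂ⟦t⟧ requires. -/
instance : IsAdicComplete (IsLocalRing.maximalIdeal (PowerSeries ℂ)) (PowerSeries ℂ) := by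
  rw [PowerSeries.maximalIdeal_eq_span_X]
  infer_instance

theorem mem_maximalIdeal_iff {a : PowerSeries ℂ} :
    a ∈ IsLocalRing.maximalIdeal (PowerSeries ℂ) ↔ PowerSeries.constantCoeff a = 0 := by
  rw [PowerSeries.maximalIdeal_eq_span_X, Ideal.mem_span_singleton, PowerSeries.X_dvd_iff]

/-- Viewed as a power series in its variable, P has a Weierstrass factor D that collects the roots
reducing to 0. There is at least one such root, and not all roots are such, because the reduction
has constant term 0 and is not a pure power. Hence the factorization is proper. -/
theorem exists_mul_of_reduction {P : Polynomial (PowerSeries ℂ)} (hP : P.Monic)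
    (h0 : PowerSeries.constantCoeff (P.coeff 0) = 0) {i : ℕ} (hi : i < P.natDegree)
    (hi0 : PowerSeries.constantCoeff (P.coeff i) ≠ 0) :
    ∃ D E : Polynomial (PowerSeries ℂ), D.Monic ∧ E.Monic ∧ P = D * E ∧
      D.natDegree < P.natDegree ∧ E.natDegree < P.natDegree := by
  have hne : (P : PowerSeries (PowerSeries ℂ)).map (IsLocalRing.residue (PowerSeries ℂ)) ≠ 0 := by
    intro h
    have := congrArg (PowerSeries.coeff P.natDegree) h
    simp [hP.coeff_natDegree] at this
  obtain ⟨D, H, hDH⟩ := PowerSeries.exists_isWeierstrassFactorization hne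
  have hD := hDH.isDistinguishedAt
  have hDne : (D : PowerSeries (PowerSeries ℂ)).map (IsLocalRing.residue (PowerSeries ℂ)) ≠ 0 := by
    intro h
    have := congrArg (PowerSeries.coeff D.natDegree) h
    simp [hD.monic.coeff_natDegree] at this
  have hdeg : (D.natDegree : ℕ∞) = ((D : PowerSeries (PowerSeries ℂ)).map
      (Ideal.Quotient.mk (IsLocalRing.maximalIdeal (PowerSeries ℂ)))).order :=
    hD.coe_natDegree_eq_order_map _ 1
      (by rw [mem_maximalIdeal_iff]; simp) (by simp)
  have hPdiv := Polynomial.modByMonic_add_div P D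
  -- Subtracting P = D·H from polynomial division of P by D expresses 0 as a Weierstrass division by
  -- D; uniqueness then kills the remainder, so D divides P among polynomials.
  have hdiv : PowerSeries.IsWeierstrassDivision 0 (D : PowerSeries (PowerSeries ℂ))
      (((P /ₘ D : Polynomial (PowerSeries ℂ)) : PowerSeries (PowerSeries ℂ)) - H) (P %ₘ D) := by
    refine ⟨?_, ?_⟩
    · rw [← hdeg]
      simpa [← Polynomial.degree_eq_natDegree hD.monic.ne_zero] using
        Polynomial.degree_modByMonic_lt P hD.monic
    · have h1 := hDH.eq_mul
      rw [← hPdiv] at h1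
      simp only [Polynomial.coe_add, Polynomial.coe_mul] at h1
      linear_combination -h1
  obtain ⟨-, hr⟩ := PowerSeries.IsWeierstrassDivision.eq_zero hDne hdiv
  rw [hr, zero_add] at hPdiv
  have hE : (P /ₘ D).Monic := hD.monic.of_mul_monic_left (by rwa [hPdiv])
  have hsum : P.natDegree = D.natDegree + (P /ₘ D).natDegree := by
    rw [← hD.monic.natDegree_mul hE, hPdiv]
  refine ⟨D, P /ₘ D, hD.monic, hE, hPdiv.symm, ?_, ?_⟩
  -- If D had full degree, then P = D would be distinguished and its i-th coefficient would reduce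
  -- to 0.
  · by_contra hlt
    have hE0 : P /ₘ D = 1 := hE.natDegree_eq_zero.1 (by omega)
    rw [hE0, mul_one] at hPdiv
    rw [hPdiv] at hD
    exact hi0 (mem_maximalIdeal_iff.1 (hD.mem hi))
  -- If D = 1, then P would be a unit power series, although its constant term reduces to 0.
  · by_contra hlt
    have hD0 : D = 1 := hD.monic.natDegree_eq_zero.1 (by omega)
    have h1 := hDH.eq_mul
    have hH := hDH.isUnit
    rw [hD0, Polynomial.coe_one, one_mul] at h1
    rw [← h1, PowerSeries.isUnit_iff_constantCoeff, Polynomial.constantCoeff_coe,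
      PowerSeries.isUnit_iff_constantCoeff] at hH
    exact hH.ne_zero h0

/-! ### Fractional power series -/

/-- The embedding of `ℂ⟦t⟧` which sends `t` to `y ^ (1 / n)`. -/
def ramify (n : ℕ+) : PowerSeries ℂ →+* Frac :=
  (embDomainRingHom (R := ℂ)
    ((AddMonoidHom.mulRight ((n : ℚ)⁻¹)).comp (Nat.castAddMonoidHom ℚ))
    (fun a b h => by simpa using h)
    (fun a b => by
      have : (0 : ℚ) < (n : ℚ)⁻¹ := by positivity
      simp [mul_le_mul_iff_left₀ this])).comp
    (toPowerSeries (R := ℂ)).symm.toRingHom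

theorem coeff_ramify (n : ℕ+) (F : PowerSeries ℂ) (k : ℕ) :
    (ramify n F).coeff ((k : ℚ) * (n : ℚ)⁻¹) = PowerSeries.coeff k F :=
  embDomain_coeff (f := OrderEmbedding.ofStrictMono (fun k : ℕ => (k : ℚ) * (n : ℚ)⁻¹)
    fun a b h => mul_lt_mul_of_pos_right (Nat.cast_lt.2 h) (by positivity))
    (x := (toPowerSeries (R := ℂ)).symm F) (a := k)

theorem coeff_ramify_of_notMem (n : ℕ+) (F : PowerSeries ℂ) {e : ℚ}
    (h : ∀ k : ℕ, (n : ℚ) * e ≠ k) : (ramify n F).coeff e = 0 := by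
  refine embDomain_of_notMem_range ?_
  rintro ⟨k, rfl⟩
  refine h k ?_
  have : (n : ℚ) ≠ 0 := by positivity
  simp
  field_simp

theorem constantCoeff_eq_coeff_ramify (n : ℕ+) (F : PowerSeries ℂ) :
    PowerSeries.constantCoeff F = (ramify n F).coeff 0 := by
  simpa using (coeff_ramify n F 0).symm

theorem mem_range_ramify {n : ℕ+} {ξ : Frac} :
    ξ ∈ (ramify n).range ↔ ∀ e ∈ ξ.support, ∃ k : ℕ, (n : ℚ) * e = k := by
  constructor
  · rintro ⟨F, rfl⟩ e he
    by_contra! h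
    exact he (coeff_ramify_of_notMem n F h)
  · intro h
    refine ⟨PowerSeries.mk fun k => ξ.coeff ((k : ℚ) * (n : ℚ)⁻¹), ?_⟩
    ext e
    have hn : (n : ℚ) ≠ 0 := by positivity
    by_cases hk : ∃ k : ℕ, (n : ℚ) * e = k
    · obtain ⟨k, hk⟩ := hk
      have he : e = (k : ℚ) * (n : ℚ)⁻¹ := by field_simp; linarith
      rw [he, coeff_ramify, PowerSeries.coeff_mk]
    · have : e ∉ ξ.support := fun he => hk (h e he)
      push Not at hk
      rw [coeff_ramify_of_notMem n _ hk]
      rw [mem_support, not_not] at this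
      exact this.symm

theorem range_ramify_mono {n m : ℕ+} (h : n ∣ m) : (ramify n).range ≤ (ramify m).range := by
  intro ξ hξ
  rw [mem_range_ramify] at *
  intro e he
  obtain ⟨k, hk⟩ := hξ e he
  obtain ⟨l, rfl⟩ := h
  refine ⟨l * k, ?_⟩
  push_cast
  rw [← hk]; ring

theorem directed_range_ramify : Directed (· ≤ ·) fun n : ℕ+ => (ramify n).range := fun n m =>
  ⟨n * m, range_ramify_mono (dvd_mul_right n m), range_ramify_mono (dvd_mul_left m n)⟩

/-- The ring of fractional power series in `y`, with non-negative exponents of bounded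
denominator. -/
def puiseux : Subring Frac := ⨆ n : ℕ+, (ramify n).range

theorem mem_puiseux {ξ : Frac} : ξ ∈ puiseux ↔ ∃ n : ℕ+, ξ ∈ (ramify n).range :=
  Subring.mem_iSup_of_directed directed_range_ramify

theorem mem_puiseux_iff {ξ : Frac} :
    ξ ∈ puiseux ↔ ∃ n : ℕ, 0 < n ∧ ∀ e ∈ ξ.support, ∃ k : ℕ, (n : ℚ) * e = k := by
  rw [mem_puiseux]
  constructor
  · rintro ⟨n, hn⟩
    exact ⟨n, n.pos, mem_range_ramify.1 hn⟩
  · rintro ⟨n, hn, h⟩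
    exact ⟨⟨n, hn⟩, mem_range_ramify.2 h⟩

theorem isArc_iff {ξ : Frac} : IsArc ξ ↔ 0 < ξ.orderTop ∧ ξ ∈ puiseux := by
  rw [IsArc, mem_puiseux_iff]

theorem orderTop_nonneg_of_mem_puiseux {ξ : Frac} (h : ξ ∈ puiseux) : 0 ≤ ξ.orderTop := by
  obtain ⟨n, hn, h⟩ := mem_puiseux_iff.1 h
  rw [le_orderTop_iff_forall]
  intro e he
  by_contra hne
  obtain ⟨k, hk⟩ := h e hne
  have he : e < 0 := by exact_mod_cast he
  have hn : (0 : ℚ) < n := by exact_mod_cast hn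
  have : (0 : ℚ) ≤ k := by positivity
  nlinarith

theorem mul_single_mem_puiseux {ξ : Frac} (h : ξ ∈ puiseux) (q : ℚ)
    (hq : 0 ≤ (ξ * single q 1).orderTop) : ξ * single q 1 ∈ puiseux := by
  obtain ⟨n, hn, h⟩ := mem_puiseux_iff.1 h
  -- Shifted exponents lie in (1/n)ℤ + qℤ, so n·den(q) clears their denominators; `hq` makes them
  -- non-negative.
  refine mem_puiseux_iff.2 ⟨n * q.den, Nat.mul_pos hn q.den_pos, fun e he => ?_⟩
  have he0 : 0 ≤ e := by
    by_contra hlt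
    exact he (le_orderTop_iff_forall.1 hq e (by exact_mod_cast not_le.1 hlt))
  have he' : e - q ∈ ξ.support := by
    rw [mem_support] at he ⊢
    have := coeff_mul_single_add (r := (1 : ℂ)) (x := ξ) (a := e - q) (b := q)
    rw [sub_add_cancel, mul_one] at this
    rwa [← this]
  obtain ⟨k, hk⟩ := h _ he'
  have hd : (q.den : ℚ) * q = q.num := Rat.den_mul_eq_num q
  have hint : ((n * q.den : ℕ) : ℚ) * e = ((q.den * k + n * q.num : ℤ) : ℚ) := by
    push_cast
    rw [← hk, ← hd]; ring
  have hnn : (0 : ℤ) ≤ q.den * k + n * q.num := by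
    have : (0 : ℚ) ≤ ((q.den * k + n * q.num : ℤ) : ℚ) := by rw [← hint]; positivity
    exact_mod_cast this
  obtain ⟨l, hl⟩ := Int.eq_ofNat_of_zero_le hnn
  exact ⟨l, by rw [hint, hl]; simp⟩

/-- The embedding of `ℂ⟦t⟧` into the fractional power series which sends `t` to `y ^ (1 / n)`. -/
def ramify' (n : ℕ+) : PowerSeries ℂ →+* puiseux :=
  (ramify n).codRestrict puiseux fun F => mem_puiseux.2 ⟨n, F, rfl⟩

@[simp]
theorem coe_ramify' (n : ℕ+) (F : PowerSeries ℂ) : (ramify' n F : Frac) = ramify n F := rfl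

/-- A polynomial has finitely many coefficients, so the product of their ramification indices serves
for all of them. -/
theorem exists_lift_ramify' {P : Polynomial puiseux} (hP : P.Monic) :
    ∃ (n : ℕ+) (Q : Polynomial (PowerSeries ℂ)),
      Q.map (ramify' n) = P ∧ Q.natDegree = P.natDegree ∧ Q.Monic := by
  choose N hN using fun ξ : puiseux => mem_puiseux.1 ξ.2
  refine ⟨∏ i ∈ Finset.range (P.natDegree + 1), N (P.coeff i), ?_⟩
  refine Polynomial.lifts_and_natDegree_eq_and_monic ?_ hP
  rw [Polynomial.lifts_iff_coeff_lifts]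
  intro i
  by_cases hi : i ≤ P.natDegree
  · obtain ⟨F, hF⟩ := range_ramify_mono (Finset.dvd_prod_of_mem (fun i => N (P.coeff i))
      (Finset.mem_range.2 (Nat.lt_succ_of_le hi))) (hN (P.coeff i))
    exact ⟨F, Subtype.ext hF⟩
  · exact ⟨0, by rw [Polynomial.coeff_eq_zero_of_natDegree_lt (not_le.1 hi), map_zero]⟩

end PolarRoots
end

noncomputable section

namespace PolarRoots

open HahnSeries

/-! ### The Newton-Puiseux theorem -/

/-- Shows which translation removes the subleading coefficient (Tschirnhaus). -/
theorem coeff_taylor_natDegree_sub_one {R : Type*} [CommRing R] {P : Polynomial R}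
    (hP : P.Monic) {d : ℕ} (hd : P.natDegree = d + 1) (a : R) :
    (Polynomial.taylor a P).coeff d = P.coeff d + (d + 1 : ℕ) * a := by
  rw [Polynomial.taylor_coeff, Polynomial.eval_eq_sum_range' (n := 2)]
  · have hc : P.coeff (d + 1) = 1 := by rw [← hd, hP.coeff_natDegree]
    simp [Finset.sum_range_succ, Polynomial.hasseDeriv_coeff, add_comm 1 d, hc]
  · have := Polynomial.natDegree_hasseDeriv_le P d
    omega

/-- The Newton polygon step. With r the minimum of ord(Q_i)/(d − i), the substitution of y^r·x for
x, divided by y^(rd), keeps all coefficients of non-negative order and gives the minimizing one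
order exactly 0. -/
theorem exists_rescale {Q : Polynomial puiseux} (hQ : Q.Monic) {j : ℕ} (hj : j < Q.natDegree)
    (hj0 : Q.coeff j ≠ 0) :
    ∃ (Q' : Polynomial puiseux) (s : puiseux), Q'.Monic ∧ Q'.natDegree = Q.natDegree ∧
      Q'.scaleRoots s = Q ∧ (∀ i, Q.coeff i = 0 → Q'.coeff i = 0) ∧
      ∃ i < Q.natDegree, (Q'.coeff i : Frac).coeff 0 ≠ 0 := by
  classical
  set d := Q.natDegree with hd
  set I := (Finset.range d).filter fun i => Q.coeff i ≠ 0 with hI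
  obtain ⟨i₀, hi₀, hmin⟩ := I.exists_min_image
    (fun i => (Q.coeff i : Frac).order / ((d : ℚ) - i)) ⟨j, by simp [hI, hj, hj0]⟩
  set r := (Q.coeff i₀ : Frac).order / ((d : ℚ) - i₀) with hr
  have hmem : ∀ i ∈ I, i < d ∧ (Q.coeff i : Frac) ≠ 0 := fun i hi => by
    simpa [hI] using hi
  have hrI : ∀ i ∈ I, 0 ≤ -(r * ((d : ℚ) - i)) + (Q.coeff i : Frac).order := fun i hi => by
    have h1 : (0 : ℚ) < (d : ℚ) - i := by
      have : (i : ℚ) < d := by exact_mod_cast (hmem i hi).1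
      linarith
    have h2 := hmin i hi
    rw [le_div_iff₀ h1] at h2
    linarith
  have hr0 : 0 ≤ r := by
    have h1 : (0 : ℚ) < (d : ℚ) - i₀ := by
      have : (i₀ : ℚ) < d := by exact_mod_cast (hmem i₀ hi₀).1
      linarith
    refine div_nonneg ?_ h1.le
    have := orderTop_nonneg_of_mem_puiseux (Q.coeff i₀).2
    rw [← order_eq_orderTop_of_ne_zero (hmem i₀ hi₀).2] at this
    exact_mod_cast this
  have hb : ∀ i, i ≤ d → (Q.coeff i : Frac) * single (-(r * ((d : ℚ) - i))) 1 ∈ puiseux := by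
    intro i hi
    refine mul_single_mem_puiseux (Q.coeff i).2 _ ?_
    by_cases h0 : (Q.coeff i : Frac) = 0
    · simp [h0]
    · rw [orderTop_mul, orderTop_single one_ne_zero, ← order_eq_orderTop_of_ne_zero h0]
      rcases hi.eq_or_lt with rfl | hi
      · have hc : (Q.coeff Q.natDegree : Frac) = 1 := by rw [hQ.coeff_natDegree]; rfl
        rw [hc]; simp
      · have h2 := hrI i (by simp only [hI, Finset.mem_filter, Finset.mem_range, ne_eq]
                             exact ⟨hi, fun h => h0 (by rw [h]; rfl)⟩)
        rw [add_comm]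
        exact_mod_cast h2
  set b : ℕ → puiseux := fun i => if h : i ≤ d then ⟨_, hb i h⟩ else 0 with hbdef
  have hbi : ∀ i ≤ d, (b i : Frac) = (Q.coeff i : Frac) * single (-(r * ((d : ℚ) - i))) 1 :=
    fun i hi => by simp [hbdef, hi]
  have hbd : b d = 1 := by
    apply Subtype.ext
    rw [hbi d le_rfl, hQ.coeff_natDegree]
    simp
  set Q' : Polynomial puiseux := ∑ i ∈ Finset.range (d + 1), Polynomial.monomial i (b i) with hQ'
  have hcoeff : ∀ i, Q'.coeff i = b i := by
    intro i
    rw [hQ', Polynomial.finsetSum_coeff]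
    simp only [Polynomial.coeff_monomial, Finset.sum_ite_eq', Finset.mem_range]
    split_ifs with h
    · rfl
    · simp only [hbdef]
      rw [dif_neg (by omega)]
  have hdeg : Q'.natDegree ≤ d := Polynomial.natDegree_sum_le_of_forall_le _ _ fun i hi =>
    (Polynomial.natDegree_monomial_le _).trans (Nat.lt_succ_iff.1 (Finset.mem_range.1 hi))
  have hmon : Q'.Monic := Polynomial.monic_of_natDegree_le_of_coeff_eq_one d hdeg
    (by rw [hcoeff, hbd])
  have hdeg' : Q'.natDegree = d := le_antisymm hdeg
    (Polynomial.le_natDegree_of_ne_zero (by rw [hcoeff, hbd]; exact one_ne_zero))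
  have hs : single r (1 : ℂ) ∈ puiseux := by
    have := mul_single_mem_puiseux (Subring.one_mem puiseux) r
    rw [one_mul, orderTop_single one_ne_zero] at this
    exact this (by exact_mod_cast hr0)
  refine ⟨Q', ⟨_, hs⟩, hmon, hdeg', ?_, ?_, i₀, (hmem i₀ hi₀).1, ?_⟩
  · ext1 i
    rw [Polynomial.coeff_scaleRoots, hdeg', hcoeff]
    by_cases hi : i ≤ d
    · apply Subtype.ext
      rw [Subring.coe_mul, hbi i hi, Subring.coe_pow, single_pow, mul_assoc, single_mul_single]
      have : -(r * ((d : ℚ) - i)) + (d - i) • r = 0 := by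
        rw [nsmul_eq_mul, Nat.cast_sub hi]; ring
      rw [this]
      simp
    · rw [Polynomial.coeff_eq_zero_of_natDegree_lt (n := i) (p := Q) (by omega)]
      simp [hbdef, hi]
  · intro i hi
    rw [hcoeff]
    by_cases h : i ≤ d
    · apply Subtype.ext
      rw [hbi i h, hi]
      simp
    · simp [hbdef, h]
  · have h1 : (0 : ℚ) < (d : ℚ) - i₀ := by
      have : (i₀ : ℚ) < d := by exact_mod_cast (hmem i₀ hi₀).1
      linarith
    rw [hcoeff, hbi i₀ (hmem i₀ hi₀).1.le]
    have h2 : (0 : ℚ) = (Q.coeff i₀ : Frac).order + -(r * ((d : ℚ) - i₀)) := by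
      rw [hr]; field_simp; ring
    rw [h2, coeff_mul_single_add, mul_one]
    exact fun h => (hmem i₀ hi₀).2 (coeff_order_eq_zero.1 h)

/-- **Newton-Puiseux theorem**: monic polynomials over the ring of fractional power series split. -/
theorem puiseux_splits (P : Polynomial puiseux) (hP : P.Monic) : P.Splits := by
  induction hn : P.natDegree using Nat.strong_induction_on generalizing P with
  | _ n ih =>
  subst hn
  obtain hd | ⟨d, hd⟩ : P.natDegree = 0 ∨ ∃ d, P.natDegree = d + 1 := by
    rcases h : P.natDegree with _ | d
    · exact Or.inl rfl
    · exact Or.inr ⟨d, rfl⟩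
  · exact Polynomial.Splits.of_natDegree_eq_zero hd
  -- Translation by −P_d/(d+1) makes the subleading coefficient vanish.
  set a : puiseux := -(P.coeff d * ramify' 1 (PowerSeries.C (((d + 1 : ℕ) : ℂ)⁻¹))) with ha
  set Q := Polynomial.taylor a P with hQdef
  suffices hQs : Q.Splits by
    have := hQs.taylor (-a)
    rwa [hQdef, Polynomial.taylor_taylor, neg_add_cancel, Polynomial.taylor_zero] at this
  have hQ : Q.Monic := by
    rw [hQdef, Polynomial.taylor_apply]
    exact hP.comp_X_add_C a
  have hQd : Q.natDegree = d + 1 := by rw [hQdef, Polynomial.natDegree_taylor, hd]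
  have hQ0 : Q.coeff d = 0 := by
    rw [hQdef, coeff_taylor_natDegree_sub_one hP hd, ha]
    have : ((d + 1 : ℕ) : puiseux) * ramify' 1 (PowerSeries.C (((d + 1 : ℕ) : ℂ)⁻¹)) = 1 := by
      rw [← map_natCast (ramify' 1), ← map_mul, ← map_natCast PowerSeries.C, ← map_mul,
        mul_inv_cancel₀ (by exact_mod_cast Nat.succ_ne_zero d), map_one, map_one]
    linear_combination (-P.coeff d) * this
  by_cases hX : ∀ j < Q.natDegree, Q.coeff j = 0
  · have : Q = Polynomial.X ^ Q.natDegree := by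
      ext1 i
      rw [Polynomial.coeff_X_pow]
      rcases lt_trichotomy i Q.natDegree with h | rfl | h
      · rw [hX i h, if_neg h.ne]
      · rw [if_pos rfl, hQ.coeff_natDegree]
      · rw [if_neg h.ne', Polynomial.coeff_eq_zero_of_natDegree_lt h]
    rw [this]
    exact Polynomial.Splits.X_pow _
  push Not at hX
  obtain ⟨j, hj, hj0⟩ := hX
  obtain ⟨Q', s, hQ'm, hQ'd, hQ's, hQ'0, i₀, hi₀, hi₀c⟩ := exists_rescale hQ hj hj0
  rw [← hQ's]
  refine Polynomial.Splits.scaleRoots ?_ s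
  -- Descend to a single ring ℂ⟦t⟧, where factorizations of the reduction mod t can be lifted.
  obtain ⟨N, R, hRQ, hRd, hRm⟩ := exists_lift_ramify' hQ'm
  have hRcoeff : ∀ i, PowerSeries.constantCoeff (R.coeff i) = (Q'.coeff i : Frac).coeff 0 := by
    intro i
    rw [constantCoeff_eq_coeff_ramify N, ← hRQ, Polynomial.coeff_map, coe_ramify']
  set p := R.map (PowerSeries.constantCoeff (R := ℂ)) with hp
  have hpm : p.Monic := hRm.map _
  have hpd : p.natDegree = d + 1 := by rw [hp, hRm.natDegree_map, hRd, hQ'd, hQd]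
  have hpd0 : p.coeff d = 0 := by
    rw [hp, Polynomial.coeff_map, hRcoeff, hQ'0 d hQ0]; rfl
  have hpi : p.coeff i₀ ≠ 0 := by
    rw [hp, Polynomial.coeff_map, hRcoeff]; exact hi₀c
  obtain ⟨z, hz⟩ := IsAlgClosed.exists_root p (by
    rw [Polynomial.degree_eq_natDegree hpm.ne_zero, hpd]; exact_mod_cast Nat.succ_ne_zero d)
  set R' := Polynomial.taylor (PowerSeries.C z) R with hR'
  have hR'm : R'.Monic := by
    rw [hR', Polynomial.taylor_apply]
    exact hRm.comp_X_add_C _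
  have hR'd : R'.natDegree = d + 1 := by rw [hR', Polynomial.natDegree_taylor, hRd, hQ'd, hQd]
  have hred : R'.map (PowerSeries.constantCoeff (R := ℂ)) = Polynomial.taylor z p := by
    rw [hR', hp, Polynomial.taylor_apply, Polynomial.taylor_apply, Polynomial.map_comp]
    simp
  have hred' : ∀ i, PowerSeries.constantCoeff (R'.coeff i) = (Polynomial.taylor z p).coeff i :=
    fun i => by rw [← hred, Polynomial.coeff_map]
  -- The reduction is not (x − z)^(d+1): its zero subleading coefficient would force z = 0,
  -- contradicting the nonzero coefficient at i₀.
  have hex : ∃ i < R'.natDegree, PowerSeries.constantCoeff (R'.coeff i) ≠ 0 := by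
    by_contra! hall
    have hzero : z = 0 := by
      have := hall d (by omega)
      rw [hred', coeff_taylor_natDegree_sub_one hpm hpd, hpd0, zero_add] at this
      exact (mul_eq_zero.1 this).resolve_left (by exact_mod_cast Nat.succ_ne_zero d)
    have := hall i₀ (by omega)
    rw [hred', hzero, Polynomial.taylor_zero] at this
    exact hpi this
  obtain ⟨i, hi, hi0⟩ := hex
  obtain ⟨D, E, hD, hE, hDE, hDd, hEd⟩ := exists_mul_of_reduction hR'm (by
    rw [hred', Polynomial.taylor_coeff_zero]; exact hz) hi hi0
  have hsplit : (R'.map (ramify' N)).Splits := by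
    rw [hDE, Polynomial.map_mul]
    refine Polynomial.Splits.mul (ih _ ?_ _ (hD.map _) rfl) (ih _ ?_ _ (hE.map _) rfl)
    · rw [hD.natDegree_map]; omega
    · rw [hE.natDegree_map]; omega
  have : (Polynomial.taylor (-(ramify' N (PowerSeries.C z))) (R'.map (ramify' N))) = Q' := by
    have h1 : R'.map (ramify' N) = Polynomial.taylor (ramify' N (PowerSeries.C z)) Q' := by
      rw [hR', ← hRQ, Polynomial.taylor_apply, Polynomial.taylor_apply, Polynomial.map_comp]
      simp
    rw [h1, Polynomial.taylor_taylor, neg_add_cancel, Polynomial.taylor_zero]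
  rw [← this]
  exact hsplit.taylor _

end PolarRoots
end

noncomputable section

namespace PolarRoots

open HahnSeries

/-! ### Weierstrass preparation in `ℂ⟦x, y⟧` -/

/-- Power series in `x` over `ℂ⟦y⟧`, as elements of `ℂ⟦x, y⟧`. -/
def ofIterated : PowerSeries (PowerSeries ℂ) →+* Ser :=
  (MvPowerSeries.finSuccEquiv ℂ 1).symm.toRingHom.comp (PowerSeries.map
    (MvPowerSeries.renameEquiv ℂ (Equiv.ofUnique Unit (Fin 1))).toRingHom)

theorem cf_ofIterated (G : PowerSeries (PowerSeries ℂ)) (i j : ℕ) :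
    cf (ofIterated G) i j = PowerSeries.coeff j (PowerSeries.coeff i G) := by
  have h1 : (Finsupp.single 0 i + Finsupp.single 1 j : Fin 2 →₀ ℕ) =
      Finsupp.cons i (Finsupp.single (0 : Fin 1) j) := by
    ext k
    fin_cases k
    · simp
    · simp [Finsupp.cons]
  rw [cf, h1, ← MvPowerSeries.coeff_coeff_finSuccEquiv]
  have h2 : MvPowerSeries.finSuccEquiv ℂ 1 (ofIterated G) = PowerSeries.map
      (MvPowerSeries.renameEquiv ℂ (Equiv.ofUnique Unit (Fin 1))).toRingHom G :=
    AlgEquiv.apply_symm_apply _ _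
  rw [h2, PowerSeries.coeff_map]
  have h3 := MvPowerSeries.coeff_embDomain_rename
    (e := (Equiv.ofUnique Unit (Fin 1)).toEmbedding) (PowerSeries.coeff i G)
    (Finsupp.single () j)
  rw [Finsupp.embDomain_single] at h3
  exact h3

theorem ofIterated_surjective : Function.Surjective ofIterated := fun F =>
  ⟨PowerSeries.mk fun i => PowerSeries.mk fun j => cf F i j,
    ser_ext fun i j => by simp [cf_ofIterated]⟩

/-- Polynomials in `x` over `ℂ⟦y⟧`, as elements of `ℂ⟦x, y⟧`. -/
def ofPoly : Polynomial (PowerSeries ℂ) →+* Ser :=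
  ofIterated.comp (Polynomial.coeToPowerSeries.ringHom (R := PowerSeries ℂ))

theorem cf_ofPoly (W : Polynomial (PowerSeries ℂ)) (i j : ℕ) :
    cf (ofPoly W) i j = PowerSeries.coeff j (W.coeff i) := by
  simp [ofPoly, cf_ofIterated]

theorem dx_ofPoly (W : Polynomial (PowerSeries ℂ)) : dx (ofPoly W) = ofPoly W.derivative := by
  refine ser_ext fun i j => ?_
  have : ((i : PowerSeries ℂ) + 1) = PowerSeries.C ((i : ℂ) + 1) := by simp
  rw [cf_dx, cf_ofPoly, cf_ofPoly, Polynomial.coeff_derivative, this, PowerSeries.coeff_mul_C,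
    mul_comm]

theorem iterate_dx_ofPoly (W : Polynomial (PowerSeries ℂ)) (m : ℕ) :
    dx^[m] (ofPoly W) = ofPoly (Polynomial.derivative^[m] W) := by
  induction m generalizing W with
  | zero => rfl
  | succ m ih => rw [Function.iterate_succ_apply, dx_ofPoly, ih, Function.iterate_succ_apply]

theorem subst_ofPoly_C (a : PowerSeries ℂ) {ξ : Frac} (hξ : 0 < ξ.orderTop) :
    subst (ofPoly (Polynomial.C a)) ξ = ramify 1 a := by
  ext e
  rw [subst, SummableFamily.coeff_hsum]
  have hterm : ∀ p : ℕ × ℕ, ((SummableFamily.smulFamily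
      (fun ij : ℕ × ℕ => cf (ofPoly (Polynomial.C a)) ij.1 ij.2) (monomials ξ)) p).coeff e =
      if p.1 = 0 ∧ e = p.2 then PowerSeries.coeff p.2 a else 0 := by
    rintro ⟨i, j⟩
    rw [SummableFamily.smulFamily_toFun, monomials_apply hξ, cf_ofPoly, Polynomial.coeff_C]
    rcases eq_or_ne i 0 with rfl | hi
    · simp [coeff_single]
    · simp [hi]
  rw [finsum_congr hterm]
  by_cases h : ∃ k : ℕ, ((1 : ℕ+) : ℚ) * e = k
  · obtain ⟨k, hk⟩ := h
    have he : e = k := by simpa using hk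
    have := coeff_ramify 1 a k
    rw [finsum_eq_single _ (0, k)]
    · simp only [PNat.val_ofNat, Nat.cast_one, inv_one, mul_one] at this
      rw [he, this]
      simp
    · rintro ⟨i, j⟩ hij
      rw [if_neg]
      rintro ⟨rfl, h2⟩
      refine hij (Prod.ext rfl ?_)
      rw [he] at h2
      exact_mod_cast h2.symm
  · push Not at h
    rw [coeff_ramify_of_notMem 1 a h]
    refine finsum_eq_zero_of_forall_eq_zero fun p => if_neg fun hp => h p.2 ?_
    simp [hp.2]

theorem ofPoly_X : ofPoly Polynomial.X = MvPowerSeries.X 0 := by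
  refine ser_ext fun i j => ?_
  rw [cf_ofPoly, cf_X, Polynomial.coeff_X]
  have : (Finsupp.single 0 i + Finsupp.single 1 j = (Finsupp.single 0 1 : Fin 2 →₀ ℕ)) ↔
      1 = i ∧ j = 0 := by
    simp [Finsupp.ext_iff, Fin.forall_fin_two, eq_comm]
  simp only [this]
  by_cases h1 : 1 = i <;> by_cases h2 : j = 0 <;> simp [h1, h2, PowerSeries.coeff_one]

theorem subst_ofPoly (W : Polynomial (PowerSeries ℂ)) {ξ : Frac} (hξ : 0 < ξ.orderTop) :
    subst (ofPoly W) ξ = (W.map (ramify 1)).eval ξ := by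
  have : (substHom ξ hξ).comp ofPoly = Polynomial.eval₂RingHom (ramify 1) ξ := by
    apply Polynomial.ringHom_ext
    · intro a
      simpa using subst_ofPoly_C a hξ
    · simpa [ofPoly_X] using subst_X_zero hξ
  rw [Polynomial.eval_map]
  exact congrArg (fun φ => φ W) this

theorem hasLead_ramify (n : ℕ+) (a : PowerSeries ℂ) :
    HasLead (ramify n a) 0 (PowerSeries.constantCoeff a) := by
  rw [hasLead_iff, constantCoeff_eq_coeff_ramify n]
  exact ⟨orderTop_nonneg_of_mem_puiseux (mem_puiseux.2 ⟨n, a, rfl⟩), rfl⟩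

/-- A distinguished polynomial reduces to a power of x, so the constant term of a root has a
vanishing power. -/
theorem orderTop_pos_of_isRoot {W : Polynomial (PowerSeries ℂ)}
    (hW : W.IsDistinguishedAt (IsLocalRing.maximalIdeal (PowerSeries ℂ))) {ξ : Frac}
    (hξ : ξ ∈ puiseux) (h : W.eval₂ (ramify 1) ξ = 0) : 0 < ξ.orderTop := by
  have hlead : HasLead ξ 0 (ξ.coeff 0) :=
    hasLead_iff.2 ⟨orderTop_nonneg_of_mem_puiseux hξ, rfl⟩
  rw [Polynomial.eval₂_eq_sum_range] at h
  have hsum : HasLead (∑ i ∈ Finset.range (W.natDegree + 1), ramify 1 (W.coeff i) * ξ ^ i) 0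
      (∑ i ∈ Finset.range (W.natDegree + 1),
        PowerSeries.constantCoeff (W.coeff i) * ξ.coeff 0 ^ i) := by
    refine HasLead.multiset_sum _ fun i _ => ?_
    simpa using (hasLead_ramify 1 (W.coeff i)).mul (hlead.pow i)
  rw [h, Finset.sum_range_succ, hW.monic.coeff_natDegree, Finset.sum_eq_zero] at hsum
  · have h0 := hsum.unique HasLead.zero
    rw [zero_add, map_one, one_mul] at h0
    rw [eq_zero_of_pow_eq_zero h0] at hlead
    exact orderTop_pos_iff.2 hlead
  · intro i hi
    rw [mem_maximalIdeal_iff.1 (hW.mem (Finset.mem_range.1 hi)), zero_mul]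

/-! ### The roots of a power series -/

instance : CharZero Frac :=
  charZero_of_injective_ringHom (C_injective (Γ := ℚ) (R := ℂ))

/-- `s` is the multiset of Newton-Puiseux roots of `F`, by Weierstrass preparation. -/
def HasRoots (F : Ser) (s : Multiset Frac) : Prop :=
  (∀ ξ ∈ s, IsArc ξ) ∧ ∃ (k : ℕ) (U : Ser) (W : Polynomial (PowerSeries ℂ)),
    MvPowerSeries.constantCoeff U ≠ 0 ∧ F = MvPowerSeries.X 1 ^ k * U * ofPoly W ∧
    W.map (ramify 1) = (s.map fun ξ => Polynomial.X - Polynomial.C ξ).prod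

/-- Removing the largest power of y leaves a series regular in x, as Weierstrass preparation
demands. -/
theorem exists_eq_X_pow_mul {F : Ser} (hF : F ≠ 0) :
    ∃ (k : ℕ) (G : Ser), F = MvPowerSeries.X 1 ^ k * G ∧ ∃ i, cf G i 0 ≠ 0 := by
  classical
  have hex : ∃ j, ∃ i, cf F i j ≠ 0 := by
    by_contra! h
    exact hF (ser_ext fun i j => by rw [h j i]; simp [cf])
  obtain ⟨i, hi⟩ := Nat.find_spec hex
  set k := Nat.find hex with hk
  have hdvd : (MvPowerSeries.X 1 : Ser) ^ k ∣ F := by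
    rw [MvPowerSeries.X_pow_dvd_iff]
    intro m hm
    rw [coeff_eq_cf]
    have := Nat.find_min hex hm
    push Not at this
    exact this (m 0)
  obtain ⟨G, hG⟩ := hdvd
  refine ⟨k, G, hG, i, ?_⟩
  rw [hG, cf, MvPowerSeries.X_pow_eq, add_comm, MvPowerSeries.coeff_add_monomial_mul,
    one_mul] at hi
  simpa [cf] using hi

/-- Weierstrass preparation leaves a distinguished polynomial; Newton–Puiseux splits it, and its
roots have positive order. -/
theorem exists_hasRoots {F : Ser} (hF : F ≠ 0) : ∃ s, HasRoots F s := by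
  obtain ⟨k, G, hG, i, hi⟩ := exists_eq_X_pow_mul hF
  obtain ⟨G', rfl⟩ := ofIterated_surjective G
  rw [cf_ofIterated] at hi
  have hne : G'.map (IsLocalRing.residue (PowerSeries ℂ)) ≠ 0 := by
    intro h
    have h1 := congrArg (PowerSeries.coeff i) h
    rw [PowerSeries.coeff_map, map_zero, IsLocalRing.residue_eq_zero_iff,
      mem_maximalIdeal_iff] at h1
    exact hi (by simpa using h1)
  obtain ⟨W, H, hWH⟩ := PowerSeries.exists_isWeierstrassFactorization hne
  have hW := hWH.isDistinguishedAt
  have hWm := hW.monic.map (ramify' 1)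
  have hprod := (puiseux_splits _ hWm).eq_prod_roots_of_monic hWm
  have hmap : W.map (ramify 1) = (W.map (ramify' 1)).map puiseux.subtype := by
    rw [Polynomial.map_map]; rfl
  refine ⟨(W.map (ramify' 1)).roots.map puiseux.subtype, ?_, k, ofIterated H, W, ?_, ?_, ?_⟩
  · intro ξ hξ
    obtain ⟨η, hη, rfl⟩ := Multiset.mem_map.1 hξ
    refine isArc_iff.2 ⟨orderTop_pos_of_isRoot hW η.2 ?_, η.2⟩
    have h0 := (Polynomial.mem_roots'.1 hη).2
    rw [← Polynomial.eval_map, hmap]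
    change (Polynomial.map puiseux.subtype _).eval (puiseux.subtype η) = 0
    rw [Polynomial.eval_map_apply, h0.eq_zero, map_zero]
  · exact ((hWH.isUnit.map ofIterated).map MvPowerSeries.constantCoeff).ne_zero
  · rw [hG, hWH.eq_mul, map_mul]
    change _ * (ofPoly W * _) = _
    ring
  · rw [hmap]
    conv_lhs => rw [hprod]
    rw [Polynomial.map_multiset_prod, Multiset.map_map, Multiset.map_map]
    simp [Function.comp_def]

theorem HasRoots.mul {F G : Ser} {s t : Multiset Frac} (hF : HasRoots F s) (hG : HasRoots G t) :
    HasRoots (F * G) (s + t) := by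
  obtain ⟨hs, k, U, W, hU, rfl, hW⟩ := hF
  obtain ⟨ht, l, V, Z, hV, rfl, hZ⟩ := hG
  refine ⟨fun ξ hξ => (Multiset.mem_add.1 hξ).elim (hs ξ) (ht ξ), k + l, U * V, W * Z, ?_, ?_, ?_⟩
  · rw [map_mul]; exact mul_ne_zero hU hV
  · rw [map_mul, _root_.pow_add]; ring
  · rw [Polynomial.map_mul, hW, hZ, Multiset.map_add, Multiset.prod_add]

theorem dx_mul (F G : Ser) : dx (F * G) = dx F * G + F * dx G := by
  simp only [dx, Derivation.leibniz, smul_eq_mul]; ring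

/-- In the Leibniz formula every term with fewer than m derivatives on V vanishes along `ξ`. -/
theorem subst_iterate_dx_mul {ξ : Frac} (hξ : 0 < ξ.orderTop) (m : ℕ) (A V : Ser)
    (h : ∀ j < m, subst (dx^[j] V) ξ = 0) :
    subst (dx^[m] (A * V)) ξ = subst A ξ * subst (dx^[m] V) ξ := by
  induction m generalizing A V with
  | zero => exact subst_mul A V hξ
  | succ m ih =>
    have hadd : ∀ F G : Ser, dx^[m] (F + G) = dx^[m] F + dx^[m] G := by
      intro F G
      exact iterate_map_add (MvPowerSeries.pderiv ℂ 0 : Derivation ℂ Ser Ser) m F G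
    rw [Function.iterate_succ_apply, dx_mul, hadd, subst_add,
      ih (dx A) V fun j hj => h j (by omega), h m (by omega), mul_zero, zero_add,
      ih A (dx V) fun j hj => h (j + 1) (by omega), Function.iterate_succ_apply]

namespace HasRoots

variable {F : Ser} {s : Multiset Frac}

theorem exists_subst_eq (h : HasRoots F s) : ∃ (k : ℕ) (U : Ser),
    MvPowerSeries.constantCoeff U ≠ 0 ∧ ∀ ξ, 0 < ξ.orderTop →
      subst F ξ = single (k : ℚ) 1 * subst U ξ * (s.map fun η => ξ - η).prod := by
  obtain ⟨-, k, U, W, hU, rfl, hW⟩ := h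
  refine ⟨k, U, hU, fun ξ hξ => ?_⟩
  rw [subst_mul _ _ hξ, subst_mul _ _ hξ, subst_ofPoly W hξ, hW, Polynomial.eval_multiset_prod,
    Multiset.map_map, ← substHom_apply ξ hξ (MvPowerSeries.X 1 ^ k), map_pow, substHom_apply,
    subst_X_one hξ, single_pow]
  simp

theorem ne_zero_of_lead {U : Ser} (hU : MvPowerSeries.constantCoeff U ≠ 0) {ξ : Frac}
    (hξ : 0 < ξ.orderTop) : subst U ξ ≠ 0 := (hasLead_subst U hξ).ne_zero hU

theorem subst_eq_zero_iff (h : HasRoots F s) {ξ : Frac} (hξ : 0 < ξ.orderTop) :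
    subst F ξ = 0 ↔ ξ ∈ s := by
  obtain ⟨k, U, hU, hF⟩ := h.exists_subst_eq
  rw [hF ξ hξ, mul_eq_zero, or_iff_right, Multiset.prod_eq_zero_iff, Multiset.mem_map]
  · simp [sub_eq_zero]
  · exact mul_ne_zero (single_ne_zero one_ne_zero) (ne_zero_of_lead hU hξ)

theorem isRoot_iff (h : HasRoots F s) {ξ : Frac} : IsRoot F ξ ↔ ξ ∈ s :=
  ⟨fun hr => (h.subst_eq_zero_iff hr.1.1).1 hr.2,
    fun hs => ⟨h.1 ξ hs, (h.subst_eq_zero_iff (h.1 ξ hs).1).2 hs⟩⟩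

/-- The power of y and the unit do not vanish along `ξ`, so the first nonvanishing x-derivative is
that of the Weierstrass polynomial; characteristic 0 turns this into root multiplicity. -/
theorem rootMult_eq [DecidableEq Frac] (h : HasRoots F s) {ξ : Frac} (hξ : 0 < ξ.orderTop) :
    rootMult F ξ = s.count ξ := by
  obtain ⟨-, k, U, W, hU, rfl, hW⟩ := h
  set P := (s.map fun η => Polynomial.X - Polynomial.C η).prod with hP
  have hP0 : P ≠ 0 := (Polynomial.monic_multisetProd_X_sub_C s).ne_zero
  have hcount : P.rootMultiplicity ξ = s.count ξ := by
    rw [← Polynomial.count_roots, hP, Polynomial.roots_multiset_prod_X_sub_C]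
  have hA : subst (MvPowerSeries.X 1 ^ k * U) ξ ≠ 0 := by
    rw [subst_mul _ _ hξ, ← substHom_apply ξ hξ (MvPowerSeries.X 1 ^ k), map_pow, substHom_apply,
      subst_X_one hξ]
    exact mul_ne_zero (pow_ne_zero _ (single_ne_zero one_ne_zero)) (ne_zero_of_lead hU hξ)
  have hV : ∀ m, subst (dx^[m] (ofPoly W)) ξ = (Polynomial.derivative^[m] P).eval ξ := by
    intro m
    rw [iterate_dx_ofPoly, subst_ofPoly _ hξ, ← Polynomial.iterate_derivative_map, hW]
  have hlt : ∀ j < s.count ξ, subst (dx^[j] (ofPoly W)) ξ = 0 := fun j hj => by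
    rw [hV]
    exact Polynomial.isRoot_iterate_derivative_of_lt_rootMultiplicity (by rwa [hcount])
  have hne : subst (dx^[s.count ξ] (ofPoly W)) ξ ≠ 0 := by
    intro h0
    have := (Polynomial.lt_rootMultiplicity_iff_isRoot_iterate_derivative hP0
      (t := ξ) (n := s.count ξ)).2 fun m hm => by
        rcases hm.lt_or_eq with hm | rfl
        · rw [Polynomial.IsRoot, ← hV, hlt m hm]
        · rw [Polynomial.IsRoot, ← hV, h0]
    omega
  refine le_antisymm (Nat.sInf_le ?_) (le_csInf ⟨s.count ξ, ?_⟩ ?_)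
  · rw [Set.mem_ofPred_eq, subst_iterate_dx_mul hξ _ _ _ hlt]
    exact mul_ne_zero hA hne
  · rw [Set.mem_ofPred_eq, subst_iterate_dx_mul hξ _ _ _ hlt]
    exact mul_ne_zero hA hne
  · intro m hm
    by_contra hlt'
    rw [not_le] at hlt'
    rw [Set.mem_ofPred_eq, subst_iterate_dx_mul hξ _ _ _ fun j hj => hlt j (hj.trans hlt'),
      hlt m hlt', mul_zero] at hm
    exact hm rfl

end HasRoots

end PolarRoots
end

noncomputable section

namespace PolarRoots

open HahnSeries

/-! ### Logarithmic derivatives -/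

theorem eval_derivative_multiset_prod {K : Type*} [Field K] (s : Multiset K) {x : K}
    (h : x ∉ s) :
    (s.map fun a => Polynomial.X - Polynomial.C a).prod.derivative.eval x =
      (s.map fun a => x - a).prod * (s.map fun a => (x - a)⁻¹).sum := by
  induction s using Multiset.induction_on with
  | empty => simp
  | cons a s ih =>
    have hx : x - a ≠ 0 := fun h0 => h (by simp [sub_eq_zero.1 h0])
    have heval : (s.map fun a => Polynomial.X - Polynomial.C a).prod.eval x =
        (s.map fun a => x - a).prod := by
      rw [Polynomial.eval_multiset_prod, Multiset.map_map]
      simp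
    simp only [Multiset.map_cons, Multiset.prod_cons, Multiset.sum_cons,
      Polynomial.derivative_mul, Polynomial.derivative_X_sub_C, Polynomial.eval_add,
      Polynomial.eval_mul, Polynomial.eval_sub, Polynomial.eval_X, Polynomial.eval_C,
      Polynomial.eval_one, heval, ih fun h' => h (by simp [h'])]
    field_simp

theorem dx_X_one_pow_mul (k : ℕ) (U : Ser) :
    dx (MvPowerSeries.X 1 ^ k * U) = MvPowerSeries.X 1 ^ k * dx U := by
  have hX : dx (MvPowerSeries.X 1 ^ k) = 0 := by
    have h1 : MvPowerSeries.pderiv ℂ (0 : Fin 2) (MvPowerSeries.X 1 : Ser) = 0 := by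
      refine ser_ext fun i j => ?_
      have := cf_dx (MvPowerSeries.X 1) i j
      rw [dx] at this
      rw [this, cf_X, if_neg]
      · simp [cf]
      · simp [Finsupp.ext_iff, Fin.forall_fin_two]
    rw [dx, Derivation.leibniz_pow, h1]
    simp
  rw [dx_mul, hX, zero_mul, zero_add]

/-- Logarithmic derivative of the Weierstrass factorization: the power of y contributes nothing, and
the unit contributes v = U_x/U, of non-negative order. -/
theorem HasRoots.exists_subst_dx_eq {F : Ser} {s : Multiset Frac} (h : HasRoots F s) {ξ : Frac}
    (hξ : 0 < ξ.orderTop) (hs : ξ ∉ s) : ∃ v : Frac, 0 ≤ v.orderTop ∧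
      subst (dx F) ξ = subst F ξ * (v + (s.map fun η => (ξ - η)⁻¹).sum) := by
  obtain ⟨-, k, U, W, hU, rfl, hW⟩ := h
  have hU0 := HasRoots.ne_zero_of_lead hU hξ
  refine ⟨subst (dx U) ξ / subst U ξ, ?_, ?_⟩
  · have := ((hasLead_subst (dx U) hξ).div (hasLead_subst U hξ) hU).le
    simpa using this
  · rw [dx_mul, dx_X_one_pow_mul, dx_ofPoly, subst_add, subst_mul _ _ hξ, subst_mul _ _ hξ,
      subst_mul _ _ hξ, subst_mul _ _ hξ, subst_mul _ _ hξ, subst_ofPoly _ hξ, subst_ofPoly _ hξ,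
      ← Polynomial.derivative_map, hW, eval_derivative_multiset_prod s hs,
      Polynomial.eval_multiset_prod, Multiset.map_map]
    simp only [Function.comp_def, Polynomial.eval_sub, Polynomial.eval_X, Polynomial.eval_C,
      subst_mul (MvPowerSeries.X 1 ^ k) U hξ]
    field_simp

/-! ### Leading terms on a bar -/

theorem climbsAt_iff {B : Bar} {ξ : Frac} {a : ℂ} :
    ClimbsAt B ξ a ↔ HasLead (ξ - B.base) B.height a := by
  rw [ClimbsAt, arcOn, HasLead, sub_sub]

/-- The coefficient of `y ^ h(B)` in `ξ - λ_B`. -/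
def coord (B : Bar) (ξ : Frac) : ℂ := (ξ - B.base).coeff B.height

theorem climbs_iff {B : Bar} {ξ : Frac} :
    Climbs B ξ ↔ (B.height : WithTop ℚ) ≤ (ξ - B.base).orderTop := by
  simp only [Climbs, climbsAt_iff, hasLead_iff]
  exact ⟨fun ⟨a, h⟩ => h.1, fun h => ⟨_, h, rfl⟩⟩

theorem not_climbs_iff {B : Bar} {ξ : Frac} : ¬ Climbs B ξ ↔ BoundedBy B ξ := by
  rw [climbs_iff, not_le, BoundedBy]

theorem climbsAt_iff_coord {B : Bar} {ξ : Frac} {a : ℂ} :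
    ClimbsAt B ξ a ↔ Climbs B ξ ∧ coord B ξ = a := by
  rw [climbsAt_iff, hasLead_iff, climbs_iff, coord]

theorem arcOn_orderTop_pos {B : Bar} (hb : 0 < B.base.orderTop) (hh : 0 < B.height) (z : ℂ) :
    0 < (arcOn B z).orderTop :=
  lt_of_lt_of_le (lt_min hb (lt_of_lt_of_le (by exact_mod_cast hh) orderTop_single_le))
    min_orderTop_le_orderTop_add

theorem hasLead_arcOn_sub {B : Bar} {η : Frac} (h : Climbs B η) (z : ℂ) :
    HasLead (arcOn B z - η) B.height (z - coord B η) := by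
  have h1 : HasLead (η - B.base) B.height (coord B η) :=
    climbsAt_iff.1 (climbsAt_iff_coord.2 ⟨h, rfl⟩)
  have h2 := (HasLead.single B.height z).sub h1
  have h3 : single B.height z - (η - B.base) = arcOn B z - η := by rw [arcOn]; ring
  rwa [h3] at h2

/-- A root bounded by B parts from all arcs on B below height h(B), so the leading term of the
difference does not depend on z. -/
theorem exists_hasLead_arcOn_sub {B : Bar} {η : Frac} (h : ¬ Climbs B η) :
    ∃ (q : ℚ) (c : ℂ), q < B.height ∧ c ≠ 0 ∧ ∀ z, HasLead (arcOn B z - η) q c := by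
  have hb := not_climbs_iff.1 h
  rw [BoundedBy] at hb
  obtain ⟨q, c, hc, hq⟩ := HasLead.exists_of_ne_zero (x := η - B.base) fun h0 => by
    rw [h0, orderTop_zero] at hb
    exact not_top_lt hb
  rw [hq.orderTop_eq hc] at hb
  have hb' : q < B.height := by exact_mod_cast hb
  refine ⟨q, -c, hb', neg_ne_zero.2 hc, fun z => ?_⟩
  have h2 := ((HasLead.single B.height z).lower hb').sub hq
  have h3 : single B.height z - (η - B.base) = arcOn B z - η := by rw [arcOn]; ring
  rwa [h3, zero_sub] at h2

open Classical in
/-- The points of `B` at which the members of `s` climb, with multiplicities. -/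
def coords (B : Bar) (s : Multiset Frac) : Multiset ℂ := (s.filter (Climbs B)).map (coord B)

open Classical in
theorem coords_cons_of_climbs {B : Bar} {η : Frac} (h : Climbs B η) (s : Multiset Frac) :
    coords B (η ::ₘ s) = coord B η ::ₘ coords B s := by
  simp [coords, Multiset.filter_cons_of_pos _ h]

open Classical in
theorem coords_cons_of_not_climbs {B : Bar} {η : Frac} (h : ¬ Climbs B η) (s : Multiset Frac) :
    coords B (η ::ₘ s) = coords B s := by
  simp [coords, Multiset.filter_cons_of_neg _ h]

/-- Climbing roots contribute the factors z − a, the others nonzero constants. -/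
theorem exists_hasLead_prod (B : Bar) (s : Multiset Frac) :
    ∃ (q : ℚ) (c : ℂ), c ≠ 0 ∧ ∀ z, HasLead (s.map fun η => arcOn B z - η).prod q
      (c * ((coords B s).map fun a => z - a).prod) := by
  induction s using Multiset.induction_on with
  | empty => exact ⟨0, 1, one_ne_zero, fun z => by simpa [coords] using HasLead.one⟩
  | cons η s ih =>
    obtain ⟨q, c, hc, h⟩ := ih
    by_cases hη : Climbs B η
    · refine ⟨B.height + q, c, hc, fun z => ?_⟩
      rw [coords_cons_of_climbs hη, Multiset.map_cons, Multiset.prod_cons, Multiset.map_cons,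
        Multiset.prod_cons, mul_left_comm]
      exact (hasLead_arcOn_sub hη z).mul (h z)
    · obtain ⟨r, d, -, hd, hr⟩ := exists_hasLead_arcOn_sub hη
      refine ⟨r + q, d * c, mul_ne_zero hd hc, fun z => ?_⟩
      rw [coords_cons_of_not_climbs hη, Multiset.map_cons, Multiset.prod_cons, mul_assoc]
      exact (hr z).mul (h z)

/-- The inverse difference to a bounded root has order −r > −h(B), hence is invisible at order
−h(B). -/
theorem hasLead_sum_inv {B : Bar} {s : Multiset Frac} {z : ℂ} (hz : z ∉ coords B s) :
    HasLead (s.map fun η => (arcOn B z - η)⁻¹).sum (-B.height)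
      ((coords B s).map fun a => (z - a)⁻¹).sum := by
  induction s using Multiset.induction_on with
  | empty => simpa [coords] using HasLead.zero
  | cons η s ih =>
    by_cases hη : Climbs B η
    · rw [coords_cons_of_climbs hη] at hz ⊢
      rw [Multiset.mem_cons, not_or] at hz
      simp only [Multiset.map_cons, Multiset.sum_cons]
      exact ((hasLead_arcOn_sub hη z).inv (sub_ne_zero.2 hz.1)).add (ih hz.2)
    · obtain ⟨r, d, hr, hd, hl⟩ := exists_hasLead_arcOn_sub hη
      rw [coords_cons_of_not_climbs hη] at hz ⊢
      simp only [Multiset.map_cons, Multiset.sum_cons]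
      have := (((hl z).inv hd).lower (neg_lt_neg hr)).add (ih hz)
      rwa [zero_add] at this

theorem notMem_of_notMem_coords {B : Bar} {s : Multiset Frac} {z : ℂ} (hz : z ∉ coords B s) :
    arcOn B z ∉ s := by
  classical
  intro h
  have h1 : ClimbsAt B (arcOn B z) z := by simp [ClimbsAt]
  obtain ⟨h2, h3⟩ := climbsAt_iff_coord.1 h1
  exact hz (Multiset.mem_map.2 ⟨_, Multiset.mem_filter.2 ⟨h, h2⟩, h3⟩)

theorem HasRoots.exists_hasLead {F : Ser} {s : Multiset Frac} (h : HasRoots F s) {B : Bar}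
    (hb : 0 < B.base.orderTop) (hh : 0 < B.height) :
    ∃ (q : ℚ) (c : ℂ), c ≠ 0 ∧ ∀ z, HasLead (subst F (arcOn B z)) q
      (c * ((coords B s).map fun a => z - a).prod) := by
  obtain ⟨k, U, hU, hF⟩ := h.exists_subst_eq
  obtain ⟨q, c, hc, hl⟩ := exists_hasLead_prod B s
  refine ⟨k + 0 + q, MvPowerSeries.constantCoeff U * c, mul_ne_zero hU hc, fun z => ?_⟩
  have hz := arcOn_orderTop_pos hb hh z
  rw [hF _ hz]
  have := ((HasLead.single (k : ℚ) 1).mul (hasLead_subst U hz)).mul (hl z)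
  rwa [one_mul, ← mul_assoc] at this

theorem multiset_prod_sub_ne_zero {K : Type*} [Field K] {s : Multiset K} {z : K} (hz : z ∉ s) :
    (s.map fun a => z - a).prod ≠ 0 := by
  rw [Ne, Multiset.prod_eq_zero_iff, Multiset.mem_map]
  rintro ⟨a, ha, h⟩
  exact hz (by rwa [sub_eq_zero.1 h])

theorem HasRoots.hasLead_subst_dx {F : Ser} {s : Multiset Frac} (h : HasRoots F s) {B : Bar}
    (hb : 0 < B.base.orderTop) (hh : 0 < B.height) {z : ℂ} (hz : z ∉ coords B s) {q : ℚ} {c : ℂ}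
    (hl : HasLead (subst F (arcOn B z)) q c) :
    HasLead (subst (dx F) (arcOn B z)) (q - B.height)
      (c * ((coords B s).map fun a => (z - a)⁻¹).sum) := by
  obtain ⟨v, hv, hF⟩ := h.exists_subst_dx_eq (arcOn_orderTop_pos hb hh z)
    (notMem_of_notMem_coords hz)
  rw [hF, sub_eq_add_neg]
  have h1 : HasLead v (-B.height) 0 := HasLead.of_lt (lt_of_lt_of_le (by exact_mod_cast (by
    linarith : -B.height < 0)) hv)
  have := hl.mul (h1.add (hasLead_sum_inv hz))
  rwa [zero_add] at this

/-- Two orders, each valid for cofinitely many z, share a z and so agree; hence the choice made by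
`epsilon` is immaterial. -/
theorem nu_eq {F : Ser} {B : Bar} (hh : 0 < B.height) {q : ℚ} (h : IsGenericOrder F B q) :
    nu F B = q := by
  rw [nu, if_neg hh.ne']
  have h1 : IsGenericOrder F B (Classical.epsilon (IsGenericOrder F B)) :=
    Classical.epsilon_spec ⟨q, h⟩
  obtain ⟨z, hz⟩ := (h.and h1).exists
  have := hz.2.symm.trans hz.1
  exact_mod_cast this

theorem eventually_notMem (s : Multiset ℂ) : ∀ᶠ z in Filter.cofinite, z ∉ s := by
  classical
  rw [Filter.eventually_cofinite]
  simp

theorem HasRoots.exists_hasLead_nu {F : Ser} {s : Multiset Frac} (h : HasRoots F s) {B : Bar}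
    (hb : 0 < B.base.orderTop) (hh : 0 < B.height) :
    ∃ c : ℂ, c ≠ 0 ∧ ∀ z, HasLead (subst F (arcOn B z)) (nu F B)
      (c * ((coords B s).map fun a => z - a).prod) := by
  obtain ⟨q, c, hc, hl⟩ := h.exists_hasLead hb hh
  have : nu F B = q := nu_eq hh ((eventually_notMem (coords B s)).mono fun z hz =>
    (hl z).orderTop_eq (mul_ne_zero hc (multiset_prod_sub_ne_zero hz)))
  exact ⟨c, hc, by rwa [this]⟩

/-! ### The leading polynomial of the Jacobian determinant -/

/-- The monic polynomial with roots `s`. -/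
def rootPoly (s : Multiset ℂ) : Polynomial ℂ :=
  (s.map fun a => Polynomial.X - Polynomial.C a).prod

theorem eval_rootPoly (s : Multiset ℂ) (z : ℂ) :
    (rootPoly s).eval z = (s.map fun a => z - a).prod := by
  rw [rootPoly, Polynomial.eval_multiset_prod, Multiset.map_map]
  simp

/-- `ν_f P Q' - ν_g P' Q`, for the polynomials `P` and `Q` with roots `s` and `t`. -/
def jacPoly (p q : ℚ) (s t : Multiset ℂ) : Polynomial ℂ :=
  Polynomial.C (p : ℂ) * (rootPoly s * (rootPoly t).derivative) -
    Polynomial.C (q : ℂ) * ((rootPoly s).derivative * rootPoly t)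

variable {f g : Ser} {s t : Multiset Frac} {B : Bar}

/-- Insert the leading terms of f, g and their x-derivatives into the determinant `subst_jac`. The
points of `coords` are excluded because the logarithmic derivatives have poles there. -/
theorem exists_hasLead_jac (hf : HasRoots f s) (hg : HasRoots g t)
    (hb : 0 < B.base.orderTop) (hh : 0 < B.height) :
    ∃ c : ℂ, c ≠ 0 ∧ ∀ z, z ∉ coords B s → z ∉ coords B t →
      HasLead (single 1 1 * subst (jac f g) (arcOn B z)) (nu f B + nu g B - B.height)
        (c * (jacPoly (nu f B) (nu g B) (coords B s) (coords B t)).eval z) := by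
  obtain ⟨c, hc, hcl⟩ := hf.exists_hasLead_nu hb hh
  obtain ⟨d, hd, hdl⟩ := hg.exists_hasLead_nu hb hh
  refine ⟨c * d, mul_ne_zero hc hd, fun z hzs hzt => ?_⟩
  rw [subst_jac f g (arcOn_orderTop_pos hb hh z)]
  have h1 := (hcl z).euler.mul (hg.hasLead_subst_dx hb hh hzt (hdl z))
  have h2 := (hf.hasLead_subst_dx hb hh hzs (hcl z)).mul (hdl z).euler
  rw [← add_sub_assoc] at h1
  rw [sub_add_eq_add_sub] at h2
  convert h1.sub h2 using 1
  simp only [jacPoly, Polynomial.eval_sub, Polynomial.eval_mul, Polynomial.eval_C, eval_rootPoly]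
  rw [rootPoly, rootPoly, eval_derivative_multiset_prod _ hzs, eval_derivative_multiset_prod _ hzt]
  ring

theorem eventually_eval_ne_zero {P : Polynomial ℂ} (hP : P ≠ 0) :
    ∀ᶠ z in Filter.cofinite, P.eval z ≠ 0 :=
  (eventually_notMem P.roots).mono fun _ hz h0 => hz ((Polynomial.mem_roots hP).2 h0)

theorem jac_ne_zero (hf : HasRoots f s) (hg : HasRoots g t)
    (hb : 0 < B.base.orderTop) (hh : 0 < B.height)
    (hR : jacPoly (nu f B) (nu g B) (coords B s) (coords B t) ≠ 0) : jac f g ≠ 0 := by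
  obtain ⟨c, hc, hl⟩ := exists_hasLead_jac hf hg hb hh
  obtain ⟨z, hz, hzs, hzt⟩ := ((eventually_eval_ne_zero hR).and
    ((eventually_notMem (coords B s)).and (eventually_notMem (coords B t)))).exists
  intro h0
  have h := (hl z hzs hzt).ne_zero (mul_ne_zero hc hz)
  rw [h0, ← substHom_apply _ (arcOn_orderTop_pos hb hh z), map_zero, mul_zero] at h
  exact h rfl

/-- The leading term of y·J is computed twice, from f and g and from the roots of J. Since `jacPoly`
is nonzero, the orders agree; then the two polynomials agree at all but finitely many z. -/
theorem exists_rootPoly_jac_eq (hf : HasRoots f s) (hg : HasRoots g t)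
    (hb : 0 < B.base.orderTop) (hh : 0 < B.height)
    (hR : jacPoly (nu f B) (nu g B) (coords B s) (coords B t) ≠ 0)
    {u : Multiset Frac} (hu : HasRoots (jac f g) u) :
    ∃ κ : ℂ, κ ≠ 0 ∧ rootPoly (coords B u) =
      Polynomial.C κ * jacPoly (nu f B) (nu g B) (coords B s) (coords B t) := by
  obtain ⟨c, hc, hl⟩ := exists_hasLead_jac hf hg hb hh
  obtain ⟨d, hd, hdl⟩ := hu.exists_hasLead_nu hb hh
  have hdl' := fun z : ℂ => (HasLead.single 1 1).mul (hdl z)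
  have hgen := (eventually_notMem (coords B s)).and (eventually_notMem (coords B t))
  obtain ⟨z, hz, hzu, hzs, hzt⟩ := ((eventually_eval_ne_zero hR).and
    ((eventually_notMem (coords B u)).and hgen)).exists
  have he : (1 : ℚ) + nu (jac f g) B = nu f B + nu g B - B.height := by
    have h1 := (hl z hzs hzt).orderTop_eq (mul_ne_zero hc hz)
    have h2 := (hdl' z).orderTop_eq (mul_ne_zero one_ne_zero
      (mul_ne_zero hd (multiset_prod_sub_ne_zero hzu)))
    exact_mod_cast h2.symm.trans h1
  refine ⟨d⁻¹ * c, mul_ne_zero (inv_ne_zero hd) hc, ?_⟩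
  refine Polynomial.eq_of_infinite_eval_eq _ _ (Set.Infinite.mono ?_
    (Filter.frequently_cofinite_iff_infinite.1 hgen.frequently))
  rintro w ⟨hws, hwt⟩
  have h1 := hdl' w
  rw [he] at h1
  have h2 := h1.unique (hl w hws hwt)
  rw [Set.mem_ofPred_eq, eval_rootPoly, Polynomial.eval_mul, Polynomial.eval_C, mul_assoc, ← h2]
  field_simp

end PolarRoots
end

noncomputable section

namespace PolarRoots

/-! ### The rational function of a bar -/

theorem RatFunc_X_sub_C_ne_zero (z : ℂ) : (RatFunc.X - RatFunc.C z : RatFunc ℂ) ≠ 0 := by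
  have : (RatFunc.X - RatFunc.C z : RatFunc ℂ) =
      algebraMap (Polynomial ℂ) (RatFunc ℂ) (Polynomial.X - Polynomial.C z) := by simp
  rw [this]
  exact RatFunc.algebraMap_ne_zero (Polynomial.X_sub_C_ne_zero z)

theorem algebraMap_derivative_rootPoly (s : Multiset ℂ) :
    algebraMap (Polynomial ℂ) (RatFunc ℂ) (rootPoly s).derivative =
      algebraMap (Polynomial ℂ) (RatFunc ℂ) (rootPoly s) *
        (s.map fun a => (RatFunc.X - RatFunc.C a)⁻¹).sum := by
  induction s using Multiset.induction_on with
  | empty => simp [rootPoly]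
  | cons a s ih =>
    have hx := RatFunc_X_sub_C_ne_zero a
    have hcons : rootPoly (a ::ₘ s) = (Polynomial.X - Polynomial.C a) * rootPoly s := by
      simp [rootPoly]
    rw [hcons, Polynomial.derivative_mul, Polynomial.derivative_X_sub_C, one_mul, map_add, map_mul,
      map_mul, ih, Multiset.map_cons, Multiset.sum_cons]
    simp only [map_sub, RatFunc.algebraMap_X, RatFunc.algebraMap_C]
    field_simp

theorem sum_map_inv_eq {s : Multiset ℂ} {Z : Finset ℂ} (hZ : s.toFinset ⊆ Z) :
    (s.map fun a => (RatFunc.X - RatFunc.C a)⁻¹).sum =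
      ∑ z ∈ Z, (s.count z : RatFunc ℂ) * (RatFunc.X - RatFunc.C z)⁻¹ := by
  rw [Finset.sum_multiset_map_count, Finset.sum_subset hZ]
  · simp only [nsmul_eq_mul]
  · intro z _ hz
    simp [Multiset.count_eq_zero.2 fun h => hz (Multiset.mem_toFinset.2 h)]

/-! ### Sums of simple fractions in lowest terms -/

section SimplePoles

variable (N : Finset ℂ) (δ : ℂ → ℂ)

/-- A sum of simple fractions. -/
def simpleSum : RatFunc ℂ := ∑ z ∈ N, RatFunc.C (δ z) / (RatFunc.X - RatFunc.C z)

theorem simpleSum_mul_prod : simpleSum N δ *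
    algebraMap (Polynomial ℂ) (RatFunc ℂ) (∏ z ∈ N, (Polynomial.X - Polynomial.C z)) =
      algebraMap (Polynomial ℂ) (RatFunc ℂ)
        (∑ z ∈ N, Polynomial.C (δ z) * ∏ w ∈ N.erase z, (Polynomial.X - Polynomial.C w)) := by
  rw [simpleSum, Finset.sum_mul, map_sum]
  refine Finset.sum_congr rfl fun z hz => ?_
  have hx := RatFunc_X_sub_C_ne_zero z
  rw [← Finset.mul_prod_erase N _ hz, map_mul, map_mul, map_sub, RatFunc.algebraMap_X,
    RatFunc.algebraMap_C, RatFunc.algebraMap_C]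
  field_simp

variable {N δ}

/-- At a pole z the evident numerator takes the value δ(z)·∏(z − w) ≠ 0, so nothing cancels against
the product of the linear factors. -/
theorem denom_simpleSum (hδ : ∀ z ∈ N, δ z ≠ 0) :
    (simpleSum N δ).denom = ∏ z ∈ N, (Polynomial.X - Polynomial.C z) := by
  set D : Polynomial ℂ := ∏ z ∈ N, (Polynomial.X - Polynomial.C z) with hD
  set M := ∑ z ∈ N, Polynomial.C (δ z) * ∏ w ∈ N.erase z, (Polynomial.X - Polynomial.C w) with hM
  have hDm : D.Monic := Polynomial.monic_prod_of_monic _ _ fun z _ => Polynomial.monic_X_sub_C z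
  have hcop : IsCoprime D M := by
    refine IsCoprime.prod_left fun z hz => ?_
    have hz0 : M.eval z ≠ 0 := by
      rw [hM, Polynomial.eval_finsetSum, Finset.sum_eq_single_of_mem z hz]
      · rw [Polynomial.eval_mul, Polynomial.eval_C, Polynomial.eval_prod]
        refine mul_ne_zero (hδ z hz) (Finset.prod_ne_zero_iff.2 fun w hw => ?_)
        simpa [sub_eq_zero] using (Finset.ne_of_mem_erase hw).symm
      · intro w _ hw
        rw [Polynomial.eval_mul, Polynomial.eval_prod,
          Finset.prod_eq_zero (Finset.mem_erase.2 ⟨hw.symm, hz⟩) (by simp), mul_zero]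
    refine (Polynomial.irreducible_X_sub_C z).coprime_iff_not_dvd.2 fun h => hz0 ?_
    exact Polynomial.dvd_iff_isRoot.1 h
  have hmul : (simpleSum N δ).num * D = M * (simpleSum N δ).denom := by
    rw [RatFunc.num_mul_eq_mul_denom_iff hDm.ne_zero, ← simpleSum_mul_prod,
      mul_div_cancel_right₀ _ (RatFunc.algebraMap_ne_zero hDm.ne_zero)]
  refine Polynomial.eq_of_monic_of_associated (RatFunc.monic_denom _) hDm
    (associated_of_dvd_dvd ?_ ?_)
  · exact (RatFunc.isCoprime_num_denom _).symm.dvd_of_dvd_mul_left ⟨M, by rw [hmul]; ring⟩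
  · exact hcop.dvd_of_dvd_mul_left ⟨_, by rw [← hmul]; ring⟩

theorem simpleSum_ne_zero (hδ : ∀ z ∈ N, δ z ≠ 0) (hN : N.Nonempty) : simpleSum N δ ≠ 0 := by
  intro h
  have h1 := denom_simpleSum hδ
  rw [h, RatFunc.denom_zero] at h1
  obtain ⟨z, hz⟩ := hN
  have := congrArg (Polynomial.eval z) h1
  rw [Polynomial.eval_prod, Finset.prod_eq_zero hz (by simp)] at this
  simp at this

end SimplePoles

variable {f g : Ser} {s t : Multiset Frac} {B : Bar}

/-- Simple roots are distinct, so the cardinality of the set is the multiplicity in the multiset. -/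
theorem count_coords [DecidableEq Frac] (hs : s.Nodup) (hf : HasRoots f s) (z : ℂ) :
    (rootsAt f B z).ncard = (coords B s).count z := by
  classical
  have h1 : rootsAt f B z = ((s.toFinset.filter fun ξ => ClimbsAt B ξ z : Finset Frac) : Set Frac) := by
    ext ξ
    simp [rootsAt, hf.isRoot_iff]
  rw [h1, Set.ncard_coe_finset, coords, Multiset.count_map, Multiset.filter_filter,
    Finset.card_def, Finset.filter_val, Multiset.toFinset_val, hs.dedup]
  congr 1
  refine Multiset.filter_congr fun ξ _ => ?_
  rw [climbsAt_iff_coord, and_comm, eq_comm]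

theorem Delta_eq (hs : s.Nodup) (ht : t.Nodup) (hf : HasRoots f s) (hg : HasRoots g t) (z : ℂ) :
    Delta f g B z = nu f B * (coords B t).count z - nu g B * (coords B s).count z := by
  classical
  rw [Delta, count_coords hs hf, count_coords ht hg]

/-- The finite set of non-collinear points of a bar. -/
def noncollinearFinset (f g : Ser) (B : Bar) (a : Multiset ℂ) : Finset ℂ :=
  a.toFinset.filter fun z => Delta f g B z ≠ 0

theorem mem_points_iff (hf : HasRoots f s) (hg : HasRoots g t) {z : ℂ} :
    z ∈ points f g B ↔ z ∈ coords B s + coords B t := by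
  classical
  simp only [points, trunk, rootsAt, Set.mem_ofPred_eq, Set.Nonempty, Set.mem_union,
    hf.isRoot_iff, hg.isRoot_iff, climbsAt_iff_coord, Multiset.mem_add, coords, Multiset.mem_map,
    Multiset.mem_filter, ← exists_or, and_assoc]

theorem coe_noncollinearFinset (hf : HasRoots f s) (hg : HasRoots g t) :
    (noncollinearFinset f g B (coords B s + coords B t) : Set ℂ) = noncollinearPts f g B := by
  ext z
  rw [noncollinearPts, Set.mem_ofPred_eq, mem_points_iff hf hg]
  simp [noncollinearFinset]

theorem Delta_eq_zero_of_notMem (hs : s.Nodup) (ht : t.Nodup) (hf : HasRoots f s)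
    (hg : HasRoots g t) {z : ℂ} (hz : z ∉ coords B s + coords B t) : Delta f g B z = 0 := by
  rw [Multiset.mem_add, not_or] at hz
  rw [Delta_eq hs ht hf hg, Multiset.count_eq_zero.2 hz.1, Multiset.count_eq_zero.2 hz.2]
  simp

theorem mero_eq (hs : s.Nodup) (ht : t.Nodup) (hf : HasRoots f s) (hg : HasRoots g t) :
    mero f g B = simpleSum (noncollinearFinset f g B (coords B s + coords B t))
      fun z => (Delta f g B z : ℂ) := by
  rw [mero, simpleSum]
  refine finsum_eq_sum_of_support_subset _ fun z hz => ?_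
  have hz0 : Delta f g B z ≠ 0 := by
    intro h
    simp [h] at hz
  refine Finset.mem_coe.2 (Finset.mem_filter.2 ⟨Multiset.mem_toFinset.2 ?_, hz0⟩)
  by_contra h
  exact hz0 (Delta_eq_zero_of_notMem hs ht hf hg h)

/-- Collecting poles shows that the rational function of the bar is ν_f Q'/Q − ν_g P'/P; multiply by
P Q. -/
theorem algebraMap_jacPoly (hs : s.Nodup) (ht : t.Nodup) (hf : HasRoots f s)
    (hg : HasRoots g t) :
    algebraMap (Polynomial ℂ) (RatFunc ℂ)
      (jacPoly (nu f B) (nu g B) (coords B s) (coords B t)) =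
      algebraMap (Polynomial ℂ) (RatFunc ℂ) (rootPoly (coords B s) * rootPoly (coords B t)) *
        mero f g B := by
  classical
  have hZ : ∀ a b : Multiset ℂ, a.toFinset ⊆ (a + b).toFinset ∧ b.toFinset ⊆ (a + b).toFinset :=
    fun a b => by simp [Multiset.toFinset_add]
  have hm : mero f g B = RatFunc.C (nu f B : ℂ) *
      ((coords B t).map fun a => (RatFunc.X - RatFunc.C a)⁻¹).sum - RatFunc.C (nu g B : ℂ) *
      ((coords B s).map fun a => (RatFunc.X - RatFunc.C a)⁻¹).sum := by
    rw [sum_map_inv_eq (hZ (coords B s) (coords B t)).1,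
      sum_map_inv_eq (hZ (coords B s) (coords B t)).2, mero_eq hs ht hf hg, simpleSum,
      noncollinearFinset, Finset.sum_filter_of_ne, Finset.mul_sum, Finset.mul_sum,
      ← Finset.sum_sub_distrib]
    · refine Finset.sum_congr rfl fun z _ => ?_
      rw [Delta_eq hs ht hf hg, div_eq_mul_inv]
      push_cast
      simp only [map_sub, map_mul, map_natCast]
      ring
    · intro z _ hz h
      simp [h] at hz
  rw [hm, jacPoly, map_sub, map_mul, map_mul, map_mul, map_mul, map_mul,
    algebraMap_derivative_rootPoly, algebraMap_derivative_rootPoly, RatFunc.algebraMap_C,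
    RatFunc.algebraMap_C]
  ring

theorem meroTotal_eq : meroTotal f g B = (mero f g B).num.natDegree := by
  classical
  rw [meroTotal, ← (IsAlgClosed.splits (mero f g B).num).natDegree_eq_card_roots.symm,
    ← Multiset.toFinset_sum_count_eq]
  rw [finsum_eq_sum_of_support_subset (s := (mero f g B).num.roots.toFinset)]
  · simp only [meroMult, Polynomial.count_roots]
  · intro z hz
    rw [Function.mem_support, meroMult, ← Polynomial.count_roots] at hz
    simpa using Multiset.count_ne_zero.1 hz

theorem mero_ne_zero (hs : s.Nodup) (ht : t.Nodup) (hf : HasRoots f s) (hg : HasRoots g t)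
    (hB : ¬ IsCollinear f g B) : mero f g B ≠ 0 := by
  rw [mero_eq hs ht hf hg]
  refine simpleSum_ne_zero (fun z hz => by simpa using (Finset.mem_filter.1 hz).2) ?_
  rw [IsCollinear] at hB
  push Not at hB
  obtain ⟨z, hz, hz0⟩ := hB
  exact ⟨z, Finset.mem_filter.2 ⟨Multiset.mem_toFinset.2 ((mem_points_iff hf hg).1 hz), hz0⟩⟩

theorem rootPoly_monic (a : Multiset ℂ) : (rootPoly a).Monic :=
  Polynomial.monic_multisetProd_X_sub_C a

theorem natDegree_rootPoly (a : Multiset ℂ) : (rootPoly a).natDegree = a.card :=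
  Polynomial.natDegree_multiset_prod_X_sub_C_eq_card a

theorem rootMultiplicity_rootPoly (a : Multiset ℂ) (z : ℂ) :
    (rootPoly a).rootMultiplicity z = a.count z := by
  classical
  rw [← Polynomial.count_roots, rootPoly, Polynomial.roots_multiset_prod_X_sub_C]

theorem jacPoly_ne_zero (hs : s.Nodup) (ht : t.Nodup) (hf : HasRoots f s) (hg : HasRoots g t)
    (hB : ¬ IsCollinear f g B) :
    jacPoly (nu f B) (nu g B) (coords B s) (coords B t) ≠ 0 := by
  intro h
  have h1 := algebraMap_jacPoly (B := B) hs ht hf hg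
  rw [h, map_zero] at h1
  exact mul_ne_zero (RatFunc.algebraMap_ne_zero (mul_ne_zero (rootPoly_monic _).ne_zero
    (rootPoly_monic _).ne_zero)) (mero_ne_zero hs ht hf hg hB) h1.symm

/-- The roots of the Jacobian determinant on a non-collinear bar, in terms of those of `f`, `g`
and of the zeros and poles of the rational function of the bar. -/
theorem exists_rootPoly_jac_mul_eq (hs : s.Nodup) (ht : t.Nodup) (hf : HasRoots f s)
    (hg : HasRoots g t) (hb : 0 < B.base.orderTop) (hh : 0 < B.height)
    (hB : ¬ IsCollinear f g B) {u : Multiset Frac} (hu : HasRoots (jac f g) u) :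
    ∃ κ : ℂ, κ ≠ 0 ∧ rootPoly (coords B u) * rootPoly (noncollinearFinset f g B
      (coords B s + coords B t)).val = Polynomial.C κ *
        (rootPoly (coords B s) * rootPoly (coords B t) * (mero f g B).num) := by
  obtain ⟨κ, hκ, h⟩ := exists_rootPoly_jac_eq hf hg hb hh (jacPoly_ne_zero hs ht hf hg hB) hu
  refine ⟨κ, hκ, RatFunc.algebraMap_injective ℂ ?_⟩
  have hden : rootPoly (noncollinearFinset f g B (coords B s + coords B t)).val =
      (mero f g B).denom := by
    rw [mero_eq hs ht hf hg, denom_simpleSum]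
    · rfl
    · exact fun z hz => by simpa using (Finset.mem_filter.1 hz).2
  have hnum : mero f g B * algebraMap (Polynomial ℂ) (RatFunc ℂ) (mero f g B).denom =
      algebraMap (Polynomial ℂ) (RatFunc ℂ) (mero f g B).num := by
    refine (div_eq_iff ?_).1 (RatFunc.num_div_denom (mero f g B)) |>.symm
    exact RatFunc.algebraMap_ne_zero (RatFunc.denom_ne_zero _)
  rw [h, hden, map_mul, map_mul, algebraMap_jacPoly hs ht hf hg, map_mul, map_mul, map_mul,
    ← hnum, map_mul]
  ring

/-- Compare degrees: the denominator of the rational function has degree n(B), its numerator m(B).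
-/
theorem card_coords_jac (hs : s.Nodup) (ht : t.Nodup) (hf : HasRoots f s) (hg : HasRoots g t)
    (hb : 0 < B.base.orderTop) (hh : 0 < B.height) (hB : ¬ IsCollinear f g B)
    {u : Multiset Frac} (hu : HasRoots (jac f g) u) :
    (coords B u).card + nPts f g B =
    (coords B s).card + (coords B t).card + meroTotal f g B := by
  obtain ⟨κ, hκ, h⟩ := exists_rootPoly_jac_mul_eq hs ht hf hg hb hh hB hu
  have hn : (mero f g B).num ≠ 0 := RatFunc.num_ne_zero (mero_ne_zero hs ht hf hg hB)
  have := congrArg Polynomial.natDegree h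
  rw [(rootPoly_monic _).natDegree_mul (rootPoly_monic _), Polynomial.natDegree_C_mul hκ,
    ((rootPoly_monic _).mul (rootPoly_monic _)).natDegree_mul' hn,
    (rootPoly_monic _).natDegree_mul (rootPoly_monic _), natDegree_rootPoly, natDegree_rootPoly,
    natDegree_rootPoly, natDegree_rootPoly] at this
  rw [nPts, ← coe_noncollinearFinset hf hg, Set.ncard_coe_finset, meroTotal_eq]
  exact this

/-- Compare multiplicities at `c`, which is not a pole because Δ_B(c) = 0. -/
theorem count_coords_jac (hs : s.Nodup) (ht : t.Nodup) (hf : HasRoots f s) (hg : HasRoots g t)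
    (hb : 0 < B.base.orderTop) (hh : 0 < B.height) (hB : ¬ IsCollinear f g B)
    {u : Multiset Frac} (hu : HasRoots (jac f g) u)
    {c : ℂ} (hc : Delta f g B c = 0) : (coords B u).count c =
    (coords B s).count c + (coords B t).count c + meroMult f g B c := by
  obtain ⟨κ, hκ, h⟩ := exists_rootPoly_jac_mul_eq hs ht hf hg hb hh hB hu
  have hn : (mero f g B).num ≠ 0 := RatFunc.num_ne_zero (mero_ne_zero hs ht hf hg hB)
  have := congrArg (Polynomial.rootMultiplicity c) h
  have h0 := fun a => (rootPoly_monic a).ne_zero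
  rw [Polynomial.rootMultiplicity_mul (mul_ne_zero (h0 _) (h0 _)),
    Polynomial.rootMultiplicity_mul (mul_ne_zero (Polynomial.C_ne_zero.2 hκ)
      (mul_ne_zero (mul_ne_zero (h0 _) (h0 _)) hn)), Polynomial.rootMultiplicity_C,
    Polynomial.rootMultiplicity_mul (mul_ne_zero (mul_ne_zero (h0 _) (h0 _)) hn),
    Polynomial.rootMultiplicity_mul (mul_ne_zero (h0 _) (h0 _)), rootMultiplicity_rootPoly,
    rootMultiplicity_rootPoly, rootMultiplicity_rootPoly, rootMultiplicity_rootPoly,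
    zero_add] at this
  have hcN : c ∉ noncollinearFinset f g B (coords B s + coords B t) := fun hmem =>
    (Finset.mem_filter.1 hmem).2 hc
  rw [Multiset.count_eq_zero.2 fun hmem => hcN hmem, add_zero] at this
  rw [this, meroMult]

end PolarRoots
end

noncomputable section

namespace PolarRoots

open HahnSeries

/-! ### The tree -/

variable {f g : Ser} {B B' : Bar} {c : ℂ} {ξ η : Frac}

theorem Climbs.of_le_sub (h : Climbs B ξ) (hd : (B.height : WithTop ℚ) ≤ (η - ξ).orderTop) :
    Climbs B η := by
  rw [climbs_iff] at *
  have : η - B.base = (η - ξ) + (ξ - B.base) := by ring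
  rw [this]
  exact le_trans (le_min hd h) min_orderTop_le_orderTop_add

theorem Climbs.le_sub (h : Climbs B ξ) (h' : Climbs B η) :
    (B.height : WithTop ℚ) ≤ (η - ξ).orderTop := by
  rw [climbs_iff] at *
  have : η - ξ = (η - B.base) - (ξ - B.base) := by ring
  rw [this]
  exact le_trans (le_min h' h) min_orderTop_le_orderTop_sub

theorem ClimbsAt.of_lt_sub (h : ClimbsAt B ξ c) (hd : (B.height : WithTop ℚ) < (η - ξ).orderTop) :
    ClimbsAt B η c := by
  rw [ClimbsAt] at *
  have : η - arcOn B c = (η - ξ) + (ξ - arcOn B c) := by ring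
  rw [this]
  exact lt_of_lt_of_le (lt_min hd h) min_orderTop_le_orderTop_add

theorem ClimbsAt.lt_sub (h : ClimbsAt B ξ c) (h' : ClimbsAt B η c) :
    (B.height : WithTop ℚ) < (η - ξ).orderTop := by
  rw [ClimbsAt] at *
  have : η - ξ = (η - arcOn B c) - (ξ - arcOn B c) := by ring
  rw [this]
  exact lt_of_lt_of_le (lt_min h' h) min_orderTop_le_orderTop_sub

theorem mem_trunk : ξ ∈ trunk f g B c ↔ (IsRoot f ξ ∨ IsRoot g ξ) ∧ ClimbsAt B ξ c := by
  simp only [trunk, rootsAt, Set.mem_union, Set.mem_ofPred_eq, or_and_right]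

theorem mem_trunk.isArc (h : ξ ∈ trunk f g B c) : IsArc ξ :=
  (mem_trunk.1 h).1.elim (fun h => h.1) fun h => h.1

namespace PostBar

theorem height_lt (h : PostBar f g B c B') : B.height < B'.height := by
  obtain ⟨⟨⟨ξ, hξ, η, hη, he⟩, -⟩, -⟩ := h
  have := (mem_trunk.1 hη).2.lt_sub (mem_trunk.1 hξ).2
  rw [he] at this
  exact_mod_cast this

theorem exists_climbs (h : PostBar f g B c B') :
    ∃ ξ ∈ trunk f g B c, Climbs B' ξ := by
  obtain ⟨-, ξ, hξ, hb⟩ := h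
  refine ⟨ξ, hξ, ?_⟩
  rw [climbs_iff, hb, le_orderTop_iff_forall]
  intro e he
  rw [coeff_sub, coeff_truncLT_of_lt (by exact_mod_cast he), sub_self]

theorem climbsAt (h : PostBar f g B c B') (hξ : Climbs B' ξ) : ClimbsAt B ξ c := by
  obtain ⟨η, hη, hηB⟩ := h.exists_climbs
  refine (mem_trunk.1 hη).2.of_lt_sub (lt_of_lt_of_le ?_ (hηB.le_sub hξ))
  exact_mod_cast h.height_lt

theorem base_orderTop_pos (h : PostBar f g B c B') : 0 < B'.base.orderTop := by
  obtain ⟨-, ξ, hξ, hb⟩ := h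
  have h0 : (0 : WithTop ℚ) = ((0 : ℚ) : WithTop ℚ) := rfl
  have hpos := (mem_trunk.isArc hξ).1
  rw [h0, lt_orderTop_iff] at hpos ⊢
  intro e he
  rw [hb, HahnSeries.coeff_truncLT, hpos e he, ite_self]

end PostBar

theorem IsBar.height_nonneg (h : IsBar f g B) : 0 ≤ B.height := by
  induction h with
  | ground => exact le_rfl
  | post _ hp ih => exact ih.trans hp.height_lt.le

theorem IsBar.eq_ground_or (h : IsBar f g B) :
    B = PolarRoots.ground ∨ 0 < B.height ∧ 0 < B.base.orderTop := by
  cases h with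
  | ground => exact Or.inl rfl
  | post hB hp => exact Or.inr ⟨hB.height_nonneg.trans_lt hp.height_lt, hp.base_orderTop_pos⟩

/-- Roots have positive order, so only one trunk can grow on the ground bar. -/
theorem points_ground {z : ℂ} (hz : z ∈ points f g ground) : z = 0 := by
  obtain ⟨ξ, hξ⟩ := hz
  have h1 := climbsAt_iff.1 (mem_trunk.1 hξ).2
  have h2 := (mem_trunk.isArc hξ).1
  rw [show ξ - ground.base = ξ from sub_zero ξ] at h1
  exact h1.unique (orderTop_pos_iff.1 h2)

/-- On the ground bar, a collinear point would be the only point, and the bar itself would be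
collinear. -/
theorem IsBar.pos_of_collinear (h : IsBar f g B) (hB : ¬ IsCollinear f g B)
    (hc : c ∈ collinearPts f g B) : 0 < B.height ∧ 0 < B.base.orderTop := by
  refine h.eq_ground_or.resolve_left ?_
  rintro rfl
  refine hB fun z hz => ?_
  rw [points_ground hz, ← points_ground hc.1]
  exact hc.2

namespace LiesMinimallyOver

theorem climbsAt (h : LiesMinimallyOver f g B c B') (hξ : Climbs B' ξ) : ClimbsAt B ξ c := by
  obtain ⟨B₁, hB₁, hchain⟩ := h
  refine hB₁.climbsAt ?_
  induction hchain with
  | refl => exact hξ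
  | tail _ hstep ih =>
    obtain ⟨-, d, hd⟩ := hstep
    exact ih ⟨d, hd.climbsAt hξ⟩

theorem pos (h : LiesMinimallyOver f g B c B') (hB : 0 ≤ B.height) :
    0 < B'.height ∧ 0 < B'.base.orderTop := by
  obtain ⟨B₁, hB₁, hchain⟩ := h
  induction hchain with
  | refl => exact ⟨hB.trans_lt hB₁.height_lt, hB₁.base_orderTop_pos⟩
  | tail _ hstep ih =>
    obtain ⟨-, d, hd⟩ := hstep
    exact ⟨ih.1.trans hd.height_lt, hd.base_orderTop_pos⟩

theorem exists_climbs (h : LiesMinimallyOver f g B c B') : ∃ ξ ∈ trunk f g B c, Climbs B' ξ := by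
  have h' := h
  obtain ⟨B₁, hB₁, hchain⟩ := h
  rcases Relation.ReflTransGen.cases_tail hchain with rfl | ⟨X, -, -, d, hd⟩
  · exact hB₁.exists_climbs
  · obtain ⟨ξ, hξ, hξB⟩ := hd.exists_climbs
    exact ⟨ξ, mem_trunk.2 ⟨(mem_trunk.1 hξ).1, h'.climbsAt hξB⟩, hξB⟩

end LiesMinimallyOver

/-- Uniqueness in a cover is postulated only for roots of fg. A root climbing over the higher bar is
close enough to `ξ` to climb over the lower one too, and so identifies the two bars. -/
theorem IsCover.eq_of_climbs {S : Finset Bar} (hS : IsCover f g B c S) {X Y : Bar} (hX : X ∈ S)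
    (hY : Y ∈ S) (h : Climbs X ξ) (h' : Climbs Y ξ) : X = Y := by
  wlog hle : X.height ≤ Y.height generalizing X Y
  · exact (this hY hX h' h (not_le.1 hle).le).symm
  obtain ⟨η, hη, hηY⟩ := (hS.1 Y hY).2.exists_climbs
  have hηX : Climbs X η := h.of_le_sub (le_trans (by exact_mod_cast hle) (h'.le_sub hηY))
  exact (hS.2 η hη).unique ⟨hX, hηX⟩ ⟨hY, hηY⟩

open Classical in
/-- Series climbing over `B` at `c` either climb over exactly one bar of a cover of `c`, or are
bounded by all of them. -/
theorem IsCover.card_filter {S : Finset Bar} (hS : IsCover f g B c S) (u : Multiset Frac) :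
    (u.filter fun ξ => ClimbsAt B ξ c).card =
      (u.filter fun ξ => ClimbsAt B ξ c ∧ ∀ B' ∈ S, BoundedBy B' ξ).card +
        ∑ B' ∈ S, (u.filter (Climbs B')).card := by
  induction u using Multiset.induction_on with
  | empty => simp
  | cons ξ u ih =>
    simp only [Multiset.filter_cons, Multiset.card_add, Finset.sum_add_distrib, ih]
    suffices h : (if ClimbsAt B ξ c then ({ξ} : Multiset Frac) else 0).card =
        (if ClimbsAt B ξ c ∧ ∀ B' ∈ S, BoundedBy B' ξ then ({ξ} : Multiset Frac) else 0).card +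
        ∑ B' ∈ S, (if Climbs B' ξ then ({ξ} : Multiset Frac) else 0).card by
      omega
    by_cases hex : ∃ X ∈ S, Climbs X ξ
    · obtain ⟨X, hX, hXξ⟩ := hex
      rw [if_pos ((hS.1 X hX).2.climbsAt hXξ), if_neg fun h => not_climbs_iff.2 (h.2 X hX) hXξ,
        Finset.sum_eq_single_of_mem X hX, if_pos hXξ]
      · simp
      · intro Y hY hne
        rw [if_neg fun hYξ => hne (hS.eq_of_climbs hY hX hYξ hXξ)]
        rfl
    · push Not at hex
      rw [Finset.sum_eq_zero fun Y hY => by rw [if_neg (hex Y hY)]; rfl, add_zero]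
      have hall : ∀ Y ∈ S, BoundedBy Y ξ := fun Y hY => not_climbs_iff.1 (hex Y hY)
      by_cases h : ClimbsAt B ξ c
      · rw [if_pos h, if_pos ⟨h, hall⟩]
      · rw [if_neg h, if_neg fun h' => h h'.1]

/-! ### The polar roots -/

theorem HasRoots.nodup_of_simple {F : Ser} {s : Multiset Frac} (h : HasRoots F s)
    (hF : HasSimpleRoots F) : s.Nodup := by
  classical
  rw [Multiset.nodup_iff_count_eq_one]
  intro ξ hξ
  rw [← h.rootMult_eq (h.1 ξ hξ).1]
  exact hF ξ (h.isRoot_iff.2 hξ)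

/-- The Euler derivation kills only exponent 0, and F(ξ) has positive order because F vanishes at
the origin. -/
theorem euler_subst_ne_zero {F : Ser} (hF : MvPowerSeries.constantCoeff F = 0) {ξ : Frac}
    (hξ : 0 < ξ.orderTop) (h : subst F ξ ≠ 0) : euler (subst F ξ) ≠ 0 := by
  obtain ⟨q, a, ha, hl⟩ := HasLead.exists_of_ne_zero h
  have h1 := (hasLead_subst F hξ)
  rw [hF] at h1
  have h2 := h1.lt_of_zero
  rw [hl.orderTop_eq ha] at h2
  have hq : (0 : ℚ) < q := by exact_mod_cast h2
  exact hl.euler.ne_zero (mul_ne_zero (by exact_mod_cast hq.ne') ha)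

theorem HasRoots.subst_dx_ne_zero {F : Ser} {s : Multiset Frac} (h : HasRoots F s)
    (hs : s.Nodup) {ξ : Frac} (hξ : ξ ∈ s) : subst (dx F) ξ ≠ 0 := by
  classical
  have h1 := h.rootMult_eq (h.1 ξ hξ).1
  rw [Multiset.count_eq_one_of_mem hs hξ] at h1
  have h2 := Nat.sInf_mem (Nat.nonempty_of_sInf_eq_succ h1)
  rw [← rootMult, h1] at h2
  exact h2

/-- Along a root of f, y·J reduces to −f_x·(y d/dy g). The first factor is nonzero by simplicity,
the second because f and g share no root; the situation for g is symmetric. -/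
theorem isPolarRoot_iff {s t : Multiset Frac} (hf : HasRoots f s) (hg : HasRoots g t)
    (hst : (s + t).Nodup) (hf0 : MvPowerSeries.constantCoeff f = 0)
    (hg0 : MvPowerSeries.constantCoeff g = 0) :
    IsPolarRoot f g ξ ↔ IsRoot (jac f g) ξ := by
  refine ⟨fun h => h.1, fun h => ⟨h, ?_⟩⟩
  obtain ⟨hs, ht, hdisj⟩ := Multiset.nodup_add.1 hst
  have hξ := h.1.1
  have hJ := subst_jac f g hξ
  rw [h.2, mul_zero] at hJ
  refine mul_ne_zero (fun h0 => ?_) fun h0 => ?_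
  · have hmem := (hf.subst_eq_zero_iff hξ).1 h0
    rw [h0, map_zero, zero_mul, zero_sub, eq_comm, neg_eq_zero] at hJ
    exact mul_ne_zero (hf.subst_dx_ne_zero hs hmem) (euler_subst_ne_zero hg0 hξ fun h1 =>
      Multiset.disjoint_left.1 hdisj hmem ((hg.subst_eq_zero_iff hξ).1 h1)) hJ
  · have hmem := (hg.subst_eq_zero_iff hξ).1 h0
    rw [h0, map_zero, mul_zero, sub_zero, eq_comm] at hJ
    exact mul_ne_zero (euler_subst_ne_zero hf0 hξ fun h1 => Multiset.disjoint_left.1 hdisj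
      ((hf.subst_eq_zero_iff hξ).1 h1) hmem) (hg.subst_dx_ne_zero ht hmem) hJ

open Classical in
theorem count_coords_eq_card (B : Bar) (u : Multiset Frac) (c : ℂ) :
    (coords B u).count c = (u.filter fun ξ => ClimbsAt B ξ c).card := by
  rw [coords, Multiset.count_map, Multiset.filter_filter]
  congr 1
  refine Multiset.filter_congr fun ξ _ => ?_
  rw [climbsAt_iff_coord, and_comm, eq_comm]

open Classical in
theorem card_coords (B : Bar) (u : Multiset Frac) :
    (coords B u).card = (u.filter (Climbs B)).card := by
  rw [coords, Multiset.card_map]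

open Classical in
theorem IsCover.card_filter_of_isRoot {S : Finset Bar} (hS : IsCover f g B c S)
    {u : Multiset Frac} (hu : ∀ ξ ∈ u, IsRoot f ξ ∨ IsRoot g ξ) :
    (u.filter fun ξ => ClimbsAt B ξ c).card = ∑ B' ∈ S, (u.filter (Climbs B')).card := by
  rw [hS.card_filter, Nat.add_eq_right, Multiset.card_eq_zero, Multiset.filter_eq_nil]
  rintro ξ hξ ⟨h1, h2⟩
  obtain ⟨X, ⟨hX, hXξ⟩, -⟩ := hS.2 ξ (mem_trunk.2 ⟨hu ξ hξ, h1⟩)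
  exact not_climbs_iff.2 (h2 X hX) hXξ

open Classical in
theorem finsum_rootMult {F : Ser} {u : Multiset Frac} (hu : HasRoots F u) {G : Set Frac}
    (hG : ∀ γ ∈ G, γ ∈ u) :
    G.Finite ∧ ∑ᶠ γ ∈ G, (rootMult F γ : ℤ) = ((u.filter fun γ => γ ∈ G).card : ℤ) := by
  have hfin : G.Finite := u.toFinset.finite_toSet.subset fun γ hγ => by simpa using hG γ hγ
  refine ⟨hfin, ?_⟩
  rw [finsum_mem_eq_finite_toFinset_sum _ hfin]
  have h1 : (u.filter fun γ => γ ∈ G).toFinset = hfin.toFinset := by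
    ext γ
    simpa using hG γ
  rw [← Multiset.toFinset_sum_count_eq, h1, Nat.cast_sum]
  refine Finset.sum_congr rfl fun γ hγ => ?_
  have hγ := (Set.Finite.mem_toFinset hfin).1 hγ
  rw [hu.rootMult_eq (hu.1 γ (hG γ hγ)).1, Multiset.count_filter_of_pos hγ]

end PolarRoots

end

/-! ### The count of polar roots -/

theorem theoremC (f g : PolarRoots.Ser)
    (hf : PolarRoots.IsConvergent f) (hg : PolarRoots.IsConvergent g)
    (hf0 : f ≠ 0) (hg0 : g ≠ 0)
    (hfO : MvPowerSeries.constantCoeff f = 0) (hgO : MvPowerSeries.constantCoeff g = 0)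
    (hsimple : PolarRoots.HasSimpleRoots (f * g))
    (B : PolarRoots.Bar) (hB : PolarRoots.IsBar f g B) (hBn : ¬ PolarRoots.IsCollinear f g B)
    (c : ℂ) (hc : c ∈ PolarRoots.collinearPts f g B)
    (S : Finset PolarRoots.Bar) (hS : PolarRoots.IsCover f g B c S) :
    (PolarRoots.polarRootsBetween f g B c S).Finite ∧
    ∑ᶠ γ ∈ PolarRoots.polarRootsBetween f g B c S,
        (PolarRoots.rootMult (PolarRoots.jac f g) γ : ℤ) =
      (PolarRoots.meroMult f g B c : ℤ) +
        ∑ B' ∈ S, ((PolarRoots.nPts f g B' : ℤ) - (PolarRoots.meroTotal f g B' : ℤ)) := by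
  classical
  obtain ⟨s, hs⟩ := PolarRoots.exists_hasRoots hf0
  obtain ⟨t, ht⟩ := PolarRoots.exists_hasRoots hg0
  have hst := (hs.mul ht).nodup_of_simple hsimple
  obtain ⟨hsn, htn, -⟩ := Multiset.nodup_add.1 hst
  obtain ⟨hh, hb⟩ := hB.pos_of_collinear hBn hc
  -- Non-collinearity of B already guarantees J ≠ 0, so J has a multiset of roots.
  obtain ⟨u, hu⟩ := PolarRoots.exists_hasRoots (PolarRoots.jac_ne_zero hs ht hb hh
    (PolarRoots.jacPoly_ne_zero hsn htn hs ht hBn))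
  have hmem : ∀ γ, γ ∈ PolarRoots.polarRootsBetween f g B c S ↔ γ ∈ u ∧
      PolarRoots.ClimbsAt B γ c ∧ ∀ B' ∈ S, PolarRoots.BoundedBy B' γ := fun γ => by
    rw [PolarRoots.polarRootsBetween, Set.mem_ofPred_eq,
      PolarRoots.isPolarRoot_iff hs ht hst hfO hgO, hu.isRoot_iff]
  obtain ⟨hfin, hsum⟩ := PolarRoots.finsum_rootMult hu fun γ hγ => ((hmem γ).1 hγ).1
  refine ⟨hfin, ?_⟩
  have hfilter : (u.filter fun γ => γ ∈ PolarRoots.polarRootsBetween f g B c S) =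
      u.filter fun γ => PolarRoots.ClimbsAt B γ c ∧ ∀ B' ∈ S, PolarRoots.BoundedBy B' γ :=
    Multiset.filter_congr fun γ hγ => by rw [hmem, and_iff_right hγ]
  rw [hsum, hfilter]
  have hJ := hS.card_filter u
  have hcs := hS.card_filter_of_isRoot (u := s) fun ξ hξ => Or.inl (hs.isRoot_iff.2 hξ)
  have hct := hS.card_filter_of_isRoot (u := t) fun ξ hξ => Or.inr (ht.isRoot_iff.2 hξ)
  have hcount := PolarRoots.count_coords_jac hsn htn hs ht hb hh hBn hu hc.2
  simp only [PolarRoots.count_coords_eq_card] at hcount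
  -- Each summand n − m is the deficit of roots of J against roots of fg over that cover bar; after
  -- summation the roots of fg add up to those climbing over B at c.
  have hcard : ∀ B' ∈ S, ((PolarRoots.nPts f g B' : ℤ) - (PolarRoots.meroTotal f g B' : ℤ)) =
      ((s.filter (PolarRoots.Climbs B')).card : ℤ) + ((t.filter (PolarRoots.Climbs B')).card : ℤ) -
        ((u.filter (PolarRoots.Climbs B')).card : ℤ) := fun B' hB' => by
    obtain ⟨hh', hb'⟩ := (hS.1 B' hB').2.pos hh.le
    have := PolarRoots.card_coords_jac hsn htn hs ht hb' hh' (hS.1 B' hB').1 hu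
    simp only [PolarRoots.card_coords] at this
    omega
  rw [Finset.sum_congr rfl hcard, Finset.sum_sub_distrib, Finset.sum_add_distrib,
    ← Nat.cast_sum, ← Nat.cast_sum, ← Nat.cast_sum, ← hcs, ← hct]
  omega
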